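/- For $X>0$ let $f_X:[0,\infty)\to\mathbb R$ be the continuous function $$f_X(\ell)=\begin{cases}\ln\left(\dfrac{\cosh\ell+\sinh\ell}{\cosh\ell+\sqrt{\sinh^2\ell-X^2}}\right) & \text{if } X\le 2\sinh(\ell/2),\\[2mm] \ln\left(\dfrac{(\cosh\ell+\sinh\ell)(1+X^2)}{(\cosh\ell+\sqrt{\sinh^2\ell-X^2})^2}\right) & \text{if } 2\sinh(\ell/2)\le X\le\sinh\ell,\\[2mm] \ell & \text{if } \sinh\ell\le X.\end{cases}$$ On the upper half-plane $\mathbb H$, with hyperbolic distance $d$ and hyperbolic measure $d\mu(z)=y^{-2}\,dx\,dy$ ($z=x+iy$), let $u(z,w)=\frac{|z-w|^2}{4\,\mathrm{Im}\,z\,\mathrm{Im}\,w}$, so that $\cosh d(z,w)=1+2u(z,w)$, and let $k_X$ be the point-pair kernel with $k_X(u(z,w))=f_X(d(z,w))$. Let $$h(t)=h_X(t)=\int_{\mathbb H}k_X(u(i,z))\,y^{s}\,d\mu(z),\qquad s=\tfrac12+it,$$ be its Selberg/Harish-Chandra transform. Then: (a) For every $X>0$, $h(i/2)=\pi X^2$.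 Moreover, for $s=\frac12+it\in(0,1)$ one has $h(t)\ll X^{\max(2-s,\,1+s)}$, with an absolute implied constant. (b) There exists $\epsilon>0$ such that for every $X>0$ the integral defining $h(t)$ converges absolutely for $|\mathrm{Im}\,t|\le\frac12+\epsilon$ and $h$ is holomorphic in a neighbourhood of this closed strip, and such that, for every $X_0>0$, $$h(t)\ll_{X_0}\frac{X^{1+\epsilon}}{(1+|t|)^2}\qquad\text{for all } t\in\mathbb R \text{ and } X\ge X_0.$$ -/

import Mathlib

open MeasureTheory

noncomputable section

/-- The function `f_X(ℓ)`, for `X > 0` and `ℓ ≥ 0`. -/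
def pairF (X l : ℝ) : ℝ :=
  if X ≤ 2 * Real.sinh (l / 2) then
    Real.log ((Real.cosh l + Real.sinh l) /
      (Real.cosh l + Real.sqrt (Real.sinh l ^ 2 - X ^ 2)))
  else if X ≤ Real.sinh l then
    Real.log ((Real.cosh l + Real.sinh l) * (1 + X ^ 2) /
      (Real.cosh l + Real.sqrt (Real.sinh l ^ 2 - X ^ 2)) ^ 2)
  else l

/-- The point-pair invariant `u(z,w) = |z - w|² / (4 Im z Im w)` on the upper half-plane. -/
def pairU (z w : UpperHalfPlane) : ℝ :=
  ‖(z : ℂ) - (w : ℂ)‖ ^ 2 / (4 * z.im * w.im)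

/-- The kernel `k_X(u)`, `u ≥ 0`, with `k_X(u) = f_X(d)` for the `d ≥ 0` such that
`cosh d = 1 + 2u`. -/
def kernelK (X u : ℝ) : ℝ := pairF X (Real.arcosh (1 + 2 * u))

theorem cosh_dist_eq_pairU (z w : UpperHalfPlane) :
    Real.cosh (dist z w) = 1 + 2 * pairU z w := by
  rw [UpperHalfPlane.cosh_dist, pairU, Complex.dist_eq]
  have h1 := z.im_pos.ne'
  have h2 := w.im_pos.ne'
  field_simp
  ring

theorem kernelK_pairU (X : ℝ) (z w : UpperHalfPlane) :
    kernelK X (pairU z w) = pairF X (dist z w) := by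
  rw [kernelK, ← cosh_dist_eq_pairU, Real.arcosh_cosh dist_nonneg]

/-- The integrand `k(u(i,z)) y^s`, `y = Im z`, `s = 1/2 + it`, of the
Selberg/Harish-Chandra transform of a kernel `k`. -/
def selbergIntegrand (k : ℝ → ℝ) (t : ℂ) (z : UpperHalfPlane) : ℂ :=
  (k (pairU UpperHalfPlane.I z) : ℂ) * (z.im : ℂ) ^ (1 / 2 + Complex.I * t)

/-- The Selberg/Harish-Chandra transform `h(t) = ∫_ℍ k(u(i,z)) y^s dμ(z)`, `s = 1/2 + it`;
`volume` on the upper half-plane is the hyperbolic measure `dx dy / y²`. -/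
def selbergTransform (k : ℝ → ℝ) (t : ℂ) : ℂ :=
  ∫ z : UpperHalfPlane, selbergIntegrand k t z

end

open MeasureTheory Filter Topology

noncomputable section

/-! In geodesic polar coordinates `(l, θ)` around `i` the height is `1/p` with `p = cosh l + sinh l
cos θ`, and the hyperbolic measure is `sinh l dl dθ`. The transform is therefore the radial integral
of `f sinh` (`weight`) against `φ(l) = ∫ p^(-s) dθ` (`sph`), as in `selbergTransform_eq_radial`.
Since `y^s` is an eigenfunction of the Laplacian, `φ` solves `(sinh φ')' = -s(1-s) sinh φ`
(`hasDerivAt_sinh_mul_sphDeriv`).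

For (a), `φ = 2π` at `s = 0` trivially and at `s = 1` by the equation, and `f sinh` has an explicit
antiderivative of total mass `X²/2` (`integral_Ioi_weight`); this gives `πX²` at both ends. At `s =
1/2` the equation makes `φ` decay at least like `cosh(l/2)^(-1/2)`, which gives `O(X^(3/2))` for `X
≥ 1` (`realTransform_half_le`). Log-convexity of `p^(-s)` in `s` interpolates between these three
values (`realTransform_interpolate`). For `X ≤ 1` the endpoint bound `X²` is already enough.

For (b), `f sinh = O_X(e^(-l))`, while the circle integral of `|p^(-s)|` grows at most like
`e^(3l/4)` for `-3/4 ≤ Re s ≤ 7/4`. This gives absolute convergence for `|Im t| ≤ 5/4`, and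
holomorphy by differentiating under the integral; `ε = 1/2` fits inside.

For the decay in real `t`, put `Λ = 1/4 + t²`. The equation turns `Λ ∫ f φ sinh` into an integral of
`f' sinh φ'`, which is integrated by parts again piece by piece. The obstruction is the inverse
square root singularity of `f'` where `sinh l = X`. A short interval next to it is estimated
directly from a bound for `φ'`, the rest from a bound for `φ`. Both bounds come from a decreasing
energy (`radial_solution_bounds`): `φ ≪ (|t| sinh l)^(-1/2)` and `φ' ≪ (|t| / sinh l)^(1/2)` for `l
≥ 1/|t|`. Cutting at `√(sinh² l - X²) = X/√|t|` removes `t` from the total, so `Λ h(t) ≪ X^(3/2)`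
(`norm_partsRemainder_sph_le`). For bounded `t` the bound at `s = 1/2` suffices. -/

/-! ### Geodesic polar coordinates around `i`. -/

/-- The inverse height `cosh l + sinh l cos θ` of the point of `ℍ` with geodesic polar coordinates
`(l, θ)` around `i`. -/
def invHeight (l θ : ℝ) : ℝ := Real.cosh l + Real.sinh l * Real.cos θ

theorem exp_neg_abs_le_invHeight (l θ : ℝ) : Real.exp (-|l|) ≤ invHeight l θ := by
  have h1 : |Real.sinh l * Real.cos θ| ≤ |Real.sinh l| := by
    rw [abs_mul]
    exact mul_le_of_le_one_right (abs_nonneg _) (Real.abs_cos_le_one θ)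
  have h2 := (abs_le.1 h1).1
  have h3 : Real.exp (-|l|) = Real.cosh l - |Real.sinh l| := by
    rw [Real.abs_sinh, ← Real.cosh_abs l, Real.cosh_sub_sinh]
  unfold invHeight
  linarith

theorem invHeight_le_exp_abs (l θ : ℝ) : invHeight l θ ≤ Real.exp |l| := by
  have h1 : |Real.sinh l * Real.cos θ| ≤ |Real.sinh l| := by
    rw [abs_mul]
    exact mul_le_of_le_one_right (abs_nonneg _) (Real.abs_cos_le_one θ)
  have h2 := (abs_le.1 h1).2
  have h3 : Real.exp |l| = Real.cosh l + |Real.sinh l| := by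
    rw [Real.abs_sinh, ← Real.cosh_abs l, Real.cosh_add_sinh]
  unfold invHeight
  linarith

theorem invHeight_pos (l θ : ℝ) : 0 < invHeight l θ :=
  (Real.exp_pos _).trans_le (exp_neg_abs_le_invHeight l θ)

theorem continuous_invHeight : Continuous fun q : ℝ × ℝ => invHeight q.1 q.2 := by
  unfold invHeight
  fun_prop

/-- The point of `ℍ` with geodesic polar coordinates `(l, θ)` around `i`. -/
def geodesicPoint (q : ℝ × ℝ) : UpperHalfPlane :=
  ⟨⟨Real.sinh q.1 * Real.sin q.2 / invHeight q.1 q.2, 1 / invHeight q.1 q.2⟩,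
    one_div_pos.2 (invHeight_pos _ _)⟩

theorem geodesicPoint_im (q : ℝ × ℝ) : (geodesicPoint q).im = (invHeight q.1 q.2)⁻¹ :=
  one_div _

theorem one_add_two_mul_pairU_geodesicPoint (q : ℝ × ℝ) :
    1 + 2 * pairU UpperHalfPlane.I (geodesicPoint q) = Real.cosh q.1 := by
  have hp := (invHeight_pos q.1 q.2).ne'
  have h1 : ‖((UpperHalfPlane.I : UpperHalfPlane) : ℂ) - (geodesicPoint q : ℂ)‖ ^ 2 =
      (Real.sinh q.1 * Real.sin q.2 / invHeight q.1 q.2) ^ 2 +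
        (1 - 1 / invHeight q.1 q.2) ^ 2 := by
    rw [← Complex.normSq_eq_norm_sq, Complex.normSq_apply]
    simp [geodesicPoint]
    ring
  rw [pairU, h1, geodesicPoint_im, UpperHalfPlane.I_im]
  have h2 := Real.sin_sq_add_cos_sq q.2
  have h3 := Real.cosh_sq q.1
  field_simp
  unfold invHeight
  linear_combination (2 * Real.sinh q.1 ^ 2) * h2 - 2 * h3

/-- `geodesicPoint` in real coordinates. -/
def polarMap (q : ℝ × ℝ) : ℝ × ℝ :=
  (Real.sinh q.1 * Real.sin q.2 / invHeight q.1 q.2, 1 / invHeight q.1 q.2)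

/-- The derivative of `polarMap`. -/
def fderivPolarMap (q : ℝ × ℝ) : ℝ × ℝ →L[ℝ] ℝ × ℝ :=
  (Matrix.toLin (.finTwoProd ℝ) (.finTwoProd ℝ)
    !![Real.sin q.2 / invHeight q.1 q.2 ^ 2,
      Real.sinh q.1 * (Real.cosh q.1 * Real.cos q.2 + Real.sinh q.1) / invHeight q.1 q.2 ^ 2;
      -(Real.sinh q.1 + Real.cosh q.1 * Real.cos q.2) / invHeight q.1 q.2 ^ 2,
      Real.sinh q.1 * Real.sin q.2 / invHeight q.1 q.2 ^ 2]).toContinuousLinearMap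

theorem hasFDerivAt_polarMap (q : ℝ × ℝ) : HasFDerivAt polarMap (fderivPolarMap q) q := by
  have hp := (invHeight_pos q.1 q.2).ne'
  have h1 : HasFDerivAt (fun q : ℝ × ℝ => q.1) (ContinuousLinearMap.fst ℝ ℝ ℝ) q := hasFDerivAt_fst
  have h2 : HasFDerivAt (fun q : ℝ × ℝ => q.2) (ContinuousLinearMap.snd ℝ ℝ ℝ) q := hasFDerivAt_snd
  have hi : HasFDerivAt (fun q : ℝ × ℝ => (invHeight q.1 q.2)⁻¹) _ q :=
    (hasDerivAt_inv hp).comp_hasFDerivAt q (h1.cosh.add (h1.sinh.mul h2.cos))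
  unfold fderivPolarMap
  rw [Matrix.toLin_finTwoProd_toContinuousLinearMap]
  have h3 := Real.cosh_sq q.1
  have h4 := Real.sin_sq_add_cos_sq q.2
  have key := HasFDerivAt.prodMk (𝕜 := ℝ) ((h1.sinh.mul h2.sin).mul hi) hi
  have e : polarMap = fun q : ℝ × ℝ => ((Real.sinh q.1 * Real.sin q.2) * (invHeight q.1 q.2)⁻¹,
      (invHeight q.1 q.2)⁻¹) := by
    funext q
    simp [polarMap, div_eq_mul_inv]
  rw [e]
  refine key.congr_fderiv ?_
  ext <;> simp
  · field_simp
    unfold invHeight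
    linear_combination Real.sin q.2 * h3
  · field_simp
    ring
  · field_simp
    unfold invHeight
    linear_combination Real.sinh q.1 ^ 2 * h4
  · field_simp

/-- The factor `p^(-2)` is the square of the height, so it cancels the density `y^(-2)` and leaves
`sinh l`. -/
theorem det_fderivPolarMap (q : ℝ × ℝ) :
    (fderivPolarMap q).det = Real.sinh q.1 / invHeight q.1 q.2 ^ 2 := by
  have hp := (invHeight_pos q.1 q.2).ne'
  have h3 := Real.cosh_sq q.1
  have h4 := Real.sin_sq_add_cos_sq q.2
  conv_lhs => rw [fderivPolarMap, ContinuousLinearMap.det, LinearMap.coe_toContinuousLinearMap,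
    LinearMap.det_toLin, Matrix.det_fin_two_of]
  field_simp
  unfold invHeight
  linear_combination Real.sinh q.1 * h4 + (Real.sinh q.1 * (Real.cos q.2 ^ 2 - 1)) * h3


/-- Recovers the radius from the Cartesian coordinates: `p` and `sinh l sin θ` determine `cosh l`.
-/
theorem two_mul_cosh_mul_invHeight (q : ℝ × ℝ) :
    2 * invHeight q.1 q.2 * Real.cosh q.1 =
      invHeight q.1 q.2 ^ 2 + (Real.sinh q.1 * Real.sin q.2) ^ 2 + 1 := by
  have h3 := Real.cosh_sq q.1
  have h4 := Real.sin_sq_add_cos_sq q.2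
  unfold invHeight
  linear_combination h3 - Real.sinh q.1 ^ 2 * h4

theorem injOn_polarMap : Set.InjOn polarMap polarCoord.target := by
  intro q hq q' hq' h
  have hp := invHeight_pos q.1 q.2
  have h1 : invHeight q.1 q.2 = invHeight q'.1 q'.2 := by
    have := congrArg Prod.snd h
    simpa [polarMap] using this
  have h2 : Real.sinh q.1 * Real.sin q.2 = Real.sinh q'.1 * Real.sin q'.2 := by
    have := congrArg Prod.fst h
    simp only [polarMap] at this
    rw [← h1] at this
    exact (div_left_inj' hp.ne').1 this
  have h3 : Real.cosh q.1 = Real.cosh q'.1 := by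
    have e1 := two_mul_cosh_mul_invHeight q
    have e2 := two_mul_cosh_mul_invHeight q'
    rw [← h1, ← h2, ← e1] at e2
    exact (mul_left_cancel₀ (by positivity) e2).symm
  have h4 : Real.sinh q.1 * Real.cos q.2 = Real.sinh q'.1 * Real.cos q'.2 := by
    unfold invHeight at h1
    linarith
  have ht : ∀ r ∈ polarCoord.target, (Real.sinh r.1, r.2) ∈ polarCoord.target := fun r hr =>
    ⟨Real.sinh_pos_iff.2 hr.1, hr.2⟩
  -- The point with Euclidean polar coordinates `(sinh l, θ)` is already determined, so injectivity
  -- is inherited from `polarCoord`.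
  have h5 := polarCoord.symm.injOn (ht q hq) (ht q' hq') (by simp [h2, h4])
  simp only [Prod.mk.injEq, Real.sinh_inj] at h5
  exact Prod.ext h5.1 h5.2

/-- Only part of the vertical line `x = 0` is missed, where the angle lies on the cut of
`polarCoord`. Elsewhere the inverse is explicit: `sinh l cos θ = v`, `sinh l sin θ = x / y` and
`cosh l = c`, so Euclidean polar coordinates of `(v, x / y)` give `sinh l` and `θ`. -/
theorem image_polarMap_ae_eq :
    polarMap '' polarCoord.target =ᵐ[volume] {w : ℝ × ℝ | 0 < w.2} := by
  have hsub : polarMap '' polarCoord.target ⊆ {w : ℝ × ℝ | 0 < w.2} := by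
    rintro _ ⟨q, -, rfl⟩
    exact one_div_pos.2 (invHeight_pos _ _)
  have hline : ∀ᵐ w : ℝ × ℝ, w.1 ≠ 0 := by
    have h : ∀ᵐ x : ℝ, x ≠ 0 := Measure.ae_ne volume 0
    exact Measure.quasiMeasurePreserving_fst.ae h
  filter_upwards [hline] with w hw
  refine propext ⟨fun h => hsub h, fun (hy : 0 < w.2) => ?_⟩
  obtain ⟨x, y⟩ := w
  simp only at hw hy
  set v : ℝ := (1 - x ^ 2 - y ^ 2) / (2 * y) with hv
  set c : ℝ := (1 + x ^ 2 + y ^ 2) / (2 * y) with hc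
  have hmem : (v, x / y) ∈ polarCoord.source := Or.inr (div_ne_zero hw hy.ne')
  have ht := polarCoord.map_source hmem
  have hl := polarCoord.left_inv hmem
  set r := polarCoord (v, x / y)
  have hr : r.1 ^ 2 = v ^ 2 + (x / y) ^ 2 := by
    have e1 : r.1 * Real.cos r.2 = v := congrArg Prod.fst hl
    have e2 : r.1 * Real.sin r.2 = x / y := congrArg Prod.snd hl
    rw [← e1, ← e2]
    linear_combination (-r.1 ^ 2) * Real.sin_sq_add_cos_sq r.2
  have hcosh : Real.cosh (Real.arsinh r.1) = c := by
    rw [Real.cosh_arsinh, Real.sqrt_eq_iff_mul_self_eq (by positivity) (by positivity), hr, hv, hc]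
    field_simp
    ring
  have hp : invHeight (Real.arsinh r.1) r.2 = y⁻¹ := by
    have e1 : r.1 * Real.cos r.2 = v := congrArg Prod.fst hl
    rw [invHeight, hcosh, Real.sinh_arsinh, e1, hc, hv]
    field_simp
    ring
  have e2 : r.1 * Real.sin r.2 = x / y := congrArg Prod.snd hl
  refine ⟨(Real.arsinh r.1, r.2), ⟨Real.arsinh_pos_iff.2 ht.1, ht.2⟩, ?_⟩
  simp only [polarMap, hp, Real.sinh_arsinh, e2]
  field_simp

theorem measurableSet_polarCoord_target : MeasurableSet polarCoord.target :=
  polarCoord.open_target.measurableSet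

/-! ### Change of variables for integrals over the upper half-plane. -/

section PolarIntegral

variable {E : Type*} [NormedAddCommGroup E] [NormedSpace ℝ E]

theorem upperHalfPlane_volume_eq_withDensity :
    (volume : Measure UpperHalfPlane) =
      ((volume.comap UpperHalfPlane.coe).withDensity
        fun z ↦ ↑((1 / NNReal.mk z.im z.im_pos.le : NNReal) ^ 2)) := rfl

theorem measurable_inv_im_sq :
    Measurable fun z : UpperHalfPlane => (1 / NNReal.mk z.im z.im_pos.le : NNReal) ^ 2 := by
  refine ((Continuous.div₀ continuous_const ?_ ?_).pow 2).measurable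
  · exact UpperHalfPlane.continuous_im.subtype_mk _
  · exact fun x ↦ NNReal.ne_iff.mp x.im_ne_zero

/-- A function on `ℍ`, weighted by `y⁻²`, as a function on `ℝ × ℝ`. -/
def halfPlaneWeighted (G : UpperHalfPlane → E) (w : ℝ × ℝ) : E :=
  (w.2⁻¹ ^ 2) • G (UpperHalfPlane.ofComplex (Complex.equivRealProd.symm w))

theorem range_coe_eq_preimage :
    Set.range UpperHalfPlane.coe =
      Complex.measurableEquivRealProd ⁻¹' {w : ℝ × ℝ | 0 < w.2} := by
  ext z
  simp only [UpperHalfPlane.range_coe]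
  rfl

theorem halfPlaneWeighted_coe (G : UpperHalfPlane → E) (z : UpperHalfPlane) :
    halfPlaneWeighted G (Complex.measurableEquivRealProd z) =
      ((1 / NNReal.mk z.im z.im_pos.le : NNReal) ^ 2) • G z := by
  have h : Complex.equivRealProd.symm (Complex.measurableEquivRealProd (z : ℂ)) = (z : ℂ) :=
    Complex.equivRealProd.symm_apply_apply _
  rw [halfPlaneWeighted, h, UpperHalfPlane.ofComplex_apply]
  simp [NNReal.smul_def, Complex.measurableEquivRealProd]

theorem integral_upperHalfPlane_eq (G : UpperHalfPlane → E) :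
    ∫ z, G z = ∫ w in {w : ℝ × ℝ | 0 < w.2}, halfPlaneWeighted G w := by
  rw [← (Complex.volume_preserving_equiv_real_prod.setIntegral_preimage_emb
    Complex.measurableEquivRealProd.measurableEmbedding), ← range_coe_eq_preimage,
    ← UpperHalfPlane.measurableEmbedding_coe.map_comap,
    UpperHalfPlane.measurableEmbedding_coe.integral_map, upperHalfPlane_volume_eq_withDensity,
    integral_withDensity_eq_integral_smul measurable_inv_im_sq]
  simp_rw [halfPlaneWeighted_coe]

theorem integrable_upperHalfPlane_iff (G : UpperHalfPlane → E) :
    Integrable G ↔ IntegrableOn (halfPlaneWeighted G) {w : ℝ × ℝ | 0 < w.2} := by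
  rw [← (Complex.volume_preserving_equiv_real_prod.integrableOn_comp_preimage
    Complex.measurableEquivRealProd.measurableEmbedding), ← range_coe_eq_preimage, IntegrableOn,
    ← UpperHalfPlane.measurableEmbedding_coe.map_comap,
    UpperHalfPlane.measurableEmbedding_coe.integrable_map_iff, upperHalfPlane_volume_eq_withDensity,
    integrable_withDensity_iff_integrable_smul measurable_inv_im_sq]
  simp_rw [Function.comp_def, halfPlaneWeighted_coe]

theorem abs_det_smul_halfPlaneWeighted (G : UpperHalfPlane → E) {q : ℝ × ℝ}
    (hq : q ∈ polarCoord.target) :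
    |(fderivPolarMap q).det| • halfPlaneWeighted G (polarMap q) =
      Real.sinh q.1 • G (geodesicPoint q) := by
  have hp := invHeight_pos q.1 q.2
  have hs : 0 < Real.sinh q.1 := Real.sinh_pos_iff.2 hq.1
  have h : Complex.equivRealProd.symm (polarMap q) = (geodesicPoint q : ℂ) := by
    apply Complex.equivRealProd.injective
    rw [Equiv.apply_symm_apply]
    rfl
  rw [det_fderivPolarMap, abs_of_pos (by positivity), halfPlaneWeighted, h,
    UpperHalfPlane.ofComplex_apply, smul_smul]
  congr 1
  simp only [polarMap]
  field_simp

/-- Integration over `ℍ` in geodesic polar coordinates. -/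
theorem integral_upperHalfPlane_polar (G : UpperHalfPlane → E) :
    ∫ z, G z = ∫ q in polarCoord.target, Real.sinh q.1 • G (geodesicPoint q) := by
  rw [integral_upperHalfPlane_eq, ← setIntegral_congr_set image_polarMap_ae_eq,
    integral_image_eq_integral_abs_det_fderiv_smul _ measurableSet_polarCoord_target
      (fun q _ => (hasFDerivAt_polarMap q).hasFDerivWithinAt) injOn_polarMap]
  exact setIntegral_congr_fun measurableSet_polarCoord_target fun q hq =>
    abs_det_smul_halfPlaneWeighted G hq

/-- Integrability over `ℍ` in geodesic polar coordinates. -/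
theorem integrable_upperHalfPlane_polar_iff (G : UpperHalfPlane → E) :
    Integrable G ↔
      IntegrableOn (fun q => Real.sinh q.1 • G (geodesicPoint q)) polarCoord.target := by
  rw [integrable_upperHalfPlane_iff, ← integrableOn_congr_set_ae image_polarMap_ae_eq,
    integrableOn_image_iff_integrableOn_abs_det_fderiv_smul _ measurableSet_polarCoord_target
      (fun q _ => (hasFDerivAt_polarMap q).hasFDerivWithinAt) injOn_polarMap]
  exact integrableOn_congr_fun (fun q hq => abs_det_smul_halfPlaneWeighted G hq)
    measurableSet_polarCoord_target

end PolarIntegral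

/-! ### Comparison of functions through their derivatives. -/

/-- Many integral estimates below take this form, with `B` an explicit antiderivative of a majorant.
Endpoints are excluded from the derivative hypotheses because `rootR` and `pairF` have corners or
singular derivatives there. -/
theorem sub_le_sub_of_hasDerivAt_le {g B g' B' : ℝ → ℝ} {a b : ℝ} (hab : a ≤ b)
    (hg : ContinuousOn g (Set.Icc a b)) (hB : ContinuousOn B (Set.Icc a b))
    (hg' : ∀ x ∈ Set.Ioo a b, HasDerivAt g (g' x) x)
    (hB' : ∀ x ∈ Set.Ioo a b, HasDerivAt B (B' x) x)
    (h : ∀ x ∈ Set.Ioo a b, g' x ≤ B' x) : g b - g a ≤ B b - B a := by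
  have hm : MonotoneOn (fun x => B x - g x) (Set.Icc a b) := by
    refine monotoneOn_of_hasDerivWithinAt_nonneg (f' := fun x => B' x - g' x) (convex_Icc a b)
      (hB.sub hg) ?_ ?_
    · intro x hx
      rw [interior_Icc] at hx
      exact ((hB' x hx).sub (hg' x hx)).hasDerivWithinAt
    · intro x hx
      rw [interior_Icc] at hx
      exact sub_nonneg.2 (h x hx)
  have := hm (Set.left_mem_Icc.2 hab) (Set.right_mem_Icc.2 hab) hab
  simp only at this
  linarith

/-- A mean value inequality that asks for derivatives in the open interval only. -/
theorem norm_sub_le_sub_of_hasDerivAt_le {g g' : ℝ → ℂ} {B B' : ℝ → ℝ} {a b : ℝ} (hab : a ≤ b)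
    (hg : ContinuousOn g (Set.Icc a b)) (hB : ContinuousOn B (Set.Icc a b))
    (hg' : ∀ x ∈ Set.Ioo a b, HasDerivAt g (g' x) x)
    (hB' : ∀ x ∈ Set.Ioo a b, HasDerivAt B (B' x) x)
    (h : ∀ x ∈ Set.Ioo a b, ‖g' x‖ ≤ B' x) : ‖g b - g a‖ ≤ B b - B a := by
  set z := g b - g a with hz
  -- Reduction to the real case: test against `w` in the unit disc, then take `w = conj z / |z|`.
  have key : ∀ w : ℂ, ‖w‖ ≤ 1 → (w * z).re ≤ B b - B a := by
    intro w hw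
    have h1 : ∀ x ∈ Set.Ioo a b, HasDerivAt (fun x => (w * g x).re) ((w * g' x).re) x := by
      intro x hx
      exact Complex.reCLM.hasFDerivAt.comp_hasDerivAt x ((hg' x hx).const_mul w)
    have := sub_le_sub_of_hasDerivAt_le hab
      (Complex.continuous_re.comp_continuousOn (continuousOn_const.mul hg)) hB h1 hB' fun x hx => by
        calc (w * g' x).re ≤ ‖w * g' x‖ := Complex.re_le_norm _
          _ ≤ 1 * ‖g' x‖ := by rw [norm_mul]; gcongr
          _ ≤ B' x := by rw [one_mul]; exact h x hx
    calc (w * z).re = (w * g b).re - (w * g a).re := by rw [hz, mul_sub, Complex.sub_re]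
      _ ≤ _ := this
  by_cases h0 : z = 0
  · have := key 0 (by simp)
    simpa [h0] using this
  · have hn : (‖z‖ : ℂ) ≠ 0 := by simpa using h0
    have := key ((starRingEnd ℂ) z / ‖z‖) (by simp [div_self (norm_ne_zero_iff.2 h0)])
    have e : (starRingEnd ℂ) z / ‖z‖ * z = ((‖z‖ : ℝ) : ℂ) := by
      rw [div_mul_eq_mul_div, mul_comm, Complex.mul_conj, Complex.normSq_eq_norm_sq]
      push_cast
      field_simp
    rwa [e, Complex.ofReal_re] at this

/-! ### The spherical function and the radial eigenvalue equation. -/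

theorem continuous_of_continuous_pair {F : ℝ → ℝ → ℂ} (hF : Continuous fun q : ℝ × ℝ => F q.1 q.2)
    (l : ℝ) : Continuous (F l) := hF.comp (Continuous.prodMk_right l)

theorem hasDerivAt_intervalIntegral_of_continuous {F F' : ℝ → ℝ → ℂ} {a b : ℝ} (hab : a ≤ b)
    (hF : Continuous fun q : ℝ × ℝ => F q.1 q.2) (hF' : Continuous fun q : ℝ × ℝ => F' q.1 q.2)
    (h : ∀ l θ, HasDerivAt (fun l => F l θ) (F' l θ) l) (l : ℝ) :
    HasDerivAt (fun l => ∫ θ in a..b, F l θ) (∫ θ in a..b, F' l θ) l := by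
  obtain ⟨C, hC⟩ := ((isCompact_Icc (a := l - 1) (b := l + 1)).prod
    (isCompact_Icc (a := a) (b := b))).exists_bound_of_continuousOn hF'.continuousOn
  have hF1 : ∀ x, Continuous (F x) := continuous_of_continuous_pair hF
  have hF2 : ∀ x, Continuous (F' x) := continuous_of_continuous_pair hF'
  refine (intervalIntegral.hasDerivAt_integral_of_dominated_loc_of_deriv_le
    (s := Metric.ball l 1) (bound := fun _ => C) (Metric.ball_mem_nhds l one_pos)
    (Filter.Eventually.of_forall fun x => (hF1 x).aestronglyMeasurable)
    ((hF1 l).intervalIntegrable _ _) (hF2 l).aestronglyMeasurable ?_ intervalIntegrable_const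
    (Filter.Eventually.of_forall fun θ _ x _ => h x θ)).2
  refine Filter.Eventually.of_forall fun θ hθ x hx => ?_
  rw [Set.uIoc_of_le hab] at hθ
  rw [Real.ball_eq_Ioo] at hx
  exact hC (x, θ) ⟨⟨hx.1.le, hx.2.le⟩, ⟨hθ.1.le, hθ.2⟩⟩

/-- The `s`-th power of the height, `invHeight l θ ^ (-s)`. -/
def heightPow (s : ℂ) (l θ : ℝ) : ℂ := Complex.exp (-s * Real.log (invHeight l θ))

/-- The derivative of `invHeight` in the radius. -/
def invHeightDeriv (l θ : ℝ) : ℝ := Real.sinh l + Real.cosh l * Real.cos θ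

/-- The spherical function of parameter `s`, times `2π`. -/
def sph (s : ℂ) (l : ℝ) : ℂ := ∫ θ in (-Real.pi)..Real.pi, heightPow s l θ

/-- The derivative of the spherical function. -/
def sphDeriv (s : ℂ) (l : ℝ) : ℂ :=
  ∫ θ in (-Real.pi)..Real.pi,
    -s * (invHeightDeriv l θ / invHeight l θ : ℝ) * heightPow s l θ

theorem norm_heightPow (s : ℂ) (l θ : ℝ) :
    ‖heightPow s l θ‖ = Real.exp (-s.re * Real.log (invHeight l θ)) := by
  rw [heightPow, Complex.norm_exp]
  simp

theorem continuous_log_invHeight :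
    Continuous fun q : ℝ × ℝ => Real.log (invHeight q.1 q.2) :=
  continuous_invHeight.log fun _ => (invHeight_pos _ _).ne'

theorem continuous_heightPow (s : ℂ) : Continuous fun q : ℝ × ℝ => heightPow s q.1 q.2 := by
  unfold heightPow
  exact Complex.continuous_exp.comp
    (continuous_const.mul (Complex.continuous_ofReal.comp continuous_log_invHeight))

theorem continuous_invHeightDeriv_div :
    Continuous fun q : ℝ × ℝ => invHeightDeriv q.1 q.2 / invHeight q.1 q.2 := by
  refine Continuous.div ?_ continuous_invHeight fun q => (invHeight_pos _ _).ne'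
  unfold invHeightDeriv
  fun_prop

theorem hasDerivAt_invHeight (l θ : ℝ) :
    HasDerivAt (fun l => invHeight l θ) (invHeightDeriv l θ) l :=
  (Real.hasDerivAt_cosh l).add ((Real.hasDerivAt_sinh l).mul_const _)

theorem hasDerivAt_heightPow (s : ℂ) (l θ : ℝ) :
    HasDerivAt (fun l => heightPow s l θ)
      (-s * (invHeightDeriv l θ / invHeight l θ : ℝ) * heightPow s l θ) l := by
  have h := (((hasDerivAt_invHeight l θ).log (invHeight_pos l θ).ne').ofReal_comp.const_mul
    (-s)).cexp
  convert! h using 1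
  rw [heightPow]
  ring

theorem hasDerivAt_heightPow_angle (s : ℂ) (l θ : ℝ) :
    HasDerivAt (fun θ => heightPow s l θ)
      (s * (Real.sinh l * Real.sin θ / invHeight l θ : ℝ) * heightPow s l θ) θ := by
  have h0 : HasDerivAt (fun θ => invHeight l θ) (Real.sinh l * -Real.sin θ) θ :=
    ((Real.hasDerivAt_cos θ).const_mul _).const_add _
  have h := ((h0.log (invHeight_pos l θ).ne').ofReal_comp.const_mul (-s)).cexp
  convert! h using 1
  rw [heightPow]
  push_cast
  ring

theorem hasDerivAt_sph (s : ℂ) (l : ℝ) : HasDerivAt (sph s) (sphDeriv s l) l :=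
  hasDerivAt_intervalIntegral_of_continuous (by linarith [Real.pi_pos]) (continuous_heightPow s)
    ((continuous_const.mul (Complex.continuous_ofReal.comp continuous_invHeightDeriv_div)).mul
      (continuous_heightPow s)) (hasDerivAt_heightPow s) l

theorem continuous_sph (s : ℂ) : Continuous (sph s) :=
  continuous_iff_continuousAt.2 fun l => (hasDerivAt_sph s l).continuousAt

/-- An antiderivative in the angle. -/
def angleFlux (s : ℂ) (l θ : ℝ) : ℂ := -s * ((Real.sin θ / invHeight l θ : ℝ) * heightPow s l θ)

/-- The derivative of `angleFlux` in the angle. -/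
def angleFluxDeriv (s : ℂ) (l θ : ℝ) : ℂ :=
  -s * (((Real.cos θ * invHeight l θ + Real.sinh l * Real.sin θ ^ 2) / invHeight l θ ^ 2 : ℝ) *
      heightPow s l θ + (Real.sin θ / invHeight l θ : ℝ) *
        (s * (Real.sinh l * Real.sin θ / invHeight l θ : ℝ) * heightPow s l θ))

theorem hasDerivAt_angleFlux (s : ℂ) (l θ : ℝ) :
    HasDerivAt (angleFlux s l) (angleFluxDeriv s l θ) θ := by
  have h0 : HasDerivAt (fun θ => invHeight l θ) (Real.sinh l * -Real.sin θ) θ :=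
    ((Real.hasDerivAt_cos θ).const_mul _).const_add _
  have h1 : HasDerivAt (fun θ => Real.sin θ / invHeight l θ)
      ((Real.cos θ * invHeight l θ + Real.sinh l * Real.sin θ ^ 2) / invHeight l θ ^ 2) θ := by
    refine ((Real.hasDerivAt_sin θ).div h0 (invHeight_pos l θ).ne').congr_deriv ?_
    ring
  exact (h1.ofReal_comp.mul (hasDerivAt_heightPow_angle s l θ)).const_mul (-s)

theorem continuous_angleFluxDeriv (s : ℂ) :
    Continuous fun q : ℝ × ℝ => angleFluxDeriv s q.1 q.2 := by
  have hci := continuous_invHeight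
  have hcp := continuous_heightPow s
  have h1 : Continuous fun q : ℝ × ℝ => (Real.cos q.2 * invHeight q.1 q.2 +
      Real.sinh q.1 * Real.sin q.2 ^ 2) / invHeight q.1 q.2 ^ 2 :=
    Continuous.div (by fun_prop) (by fun_prop) fun _ => pow_ne_zero 2 (invHeight_pos _ _).ne'
  have h2 : Continuous fun q : ℝ × ℝ => Real.sin q.2 / invHeight q.1 q.2 :=
    Continuous.div (by fun_prop) (by fun_prop) fun _ => (invHeight_pos _ _).ne'
  have h3 : Continuous fun q : ℝ × ℝ => Real.sinh q.1 * Real.sin q.2 / invHeight q.1 q.2 :=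
    Continuous.div (by fun_prop) (by fun_prop) fun _ => (invHeight_pos _ _).ne'
  exact continuous_const.mul (((Complex.continuous_ofReal.comp h1).mul hcp).add
    ((Complex.continuous_ofReal.comp h2).mul
      ((continuous_const.mul (Complex.continuous_ofReal.comp h3)).mul hcp)))

/-- The polar-coordinate form of `Δ y^s = -s(1-s) y^s`, divided by the common factor `p^(-s)`. Here
`c, S` stand for `cosh l, sinh l` and `x, y` for `cos θ, sin θ`. The last term on the right is the
angular part of the Laplacian, written as the `θ`-derivative of `angleFlux`. -/
theorem radial_laplacian_identity {s c S x y p : ℂ} (hcs : c ^ 2 = S ^ 2 + 1)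
    (hxy : y ^ 2 + x ^ 2 = 1) (hp : p = c + S * x) (hp0 : p ≠ 0) :
    c * (-s * ((S + c * x) / p)) + S * (-s * ((p * p - (S + c * x) * (S + c * x)) / p ^ 2) +
      -s * ((S + c * x) / p) * (-s * ((S + c * x) / p))) =
    -(s * (1 - s)) * S + -s * ((x * p + S * y ^ 2) / p ^ 2 + y / p * (s * (S * y / p))) := by
  have hd : (S + c * x) ^ 2 = p ^ 2 - y ^ 2 := by
    subst hp
    linear_combination (x ^ 2 - 1) * hcs + hxy
  have hcd : c * (S + c * x) = S * p + x := by
    subst hp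
    linear_combination x * hcs
  have hu : p * p⁻¹ = 1 := mul_inv_cancel₀ hp0
  clear hp
  generalize S + c * x = d at *
  simp only [div_eq_mul_inv, ← inv_pow]
  generalize p⁻¹ = u at *
  linear_combination (-s * u) * hcd + S * (s + s ^ 2) * u ^ 2 * hd +
    (-s * S + s * u * x + s ^ 2 * S * (p * u + 1)) * hu

/-- The angular second derivative enters as a total derivative of a `2π`-periodic function, so it
disappears on integrating over the circle. `angleFlux` has the factor `1 / sinh l` already
cancelled, which keeps everything smooth at `l = 0`. -/
theorem hasDerivAt_sinh_mul_heightPow_deriv (s : ℂ) (l θ : ℝ) :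
    HasDerivAt (fun l => (Real.sinh l : ℂ) *
        (-s * (invHeightDeriv l θ / invHeight l θ : ℝ) * heightPow s l θ))
      (-(s * (1 - s)) * Real.sinh l * heightPow s l θ + angleFluxDeriv s l θ) l := by
  have hp := (invHeight_pos l θ).ne'
  have hpd : HasDerivAt (fun l => invHeightDeriv l θ) (invHeight l θ) l :=
    (Real.hasDerivAt_sinh l).add ((Real.hasDerivAt_cosh l).mul_const _)
  have h1 : HasDerivAt (fun l => invHeightDeriv l θ / invHeight l θ) _ l :=
    hpd.div (hasDerivAt_invHeight l θ) hp
  have h2 := ((Real.hasDerivAt_sinh l).ofReal_comp).mul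
      ((h1.ofReal_comp.const_mul (-s)).mul (hasDerivAt_heightPow s l θ))
  refine h2.congr_deriv ?_
  have e1 : ((Real.cosh l : ℝ) : ℂ) ^ 2 = (Real.sinh l : ℝ) ^ 2 + 1 := by
    exact_mod_cast Real.cosh_sq l
  have e2 : ((Real.sin θ : ℝ) : ℂ) ^ 2 + (Real.cos θ : ℝ) ^ 2 = 1 := by
    exact_mod_cast Real.sin_sq_add_cos_sq θ
  have e3 : ((invHeight l θ : ℝ) : ℂ) = (Real.cosh l : ℝ) + (Real.sinh l : ℝ) * (Real.cos θ : ℝ) := by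
    rw [invHeight, Complex.ofReal_add, Complex.ofReal_mul]
  have e4 : ((invHeightDeriv l θ : ℝ) : ℂ) =
      (Real.sinh l : ℝ) + (Real.cosh l : ℝ) * (Real.cos θ : ℝ) := by
    rw [invHeightDeriv, Complex.ofReal_add, Complex.ofReal_mul]
  have key := radial_laplacian_identity (s := s) e1 e2 e3 (by exact_mod_cast hp)
  rw [angleFluxDeriv]
  simp only [Complex.ofReal_div, Complex.ofReal_sub, Complex.ofReal_mul, Complex.ofReal_add,
    Complex.ofReal_pow, Pi.mul_apply, e4]
  linear_combination heightPow s l θ * key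

/-- `sinh l` times the radial derivative of `heightPow`. -/
def radialFlux (s : ℂ) (l θ : ℝ) : ℂ :=
  Real.sinh l * (-s * (invHeightDeriv l θ / invHeight l θ : ℝ) * heightPow s l θ)

/-- The radial derivative of `radialFlux`. -/
def radialFluxDeriv (s : ℂ) (l θ : ℝ) : ℂ :=
  -(s * (1 - s)) * Real.sinh l * heightPow s l θ + angleFluxDeriv s l θ

theorem continuous_radialFlux (s : ℂ) : Continuous fun q : ℝ × ℝ => radialFlux s q.1 q.2 := by
  have hcp := continuous_heightPow s
  have hSc : Continuous fun q : ℝ × ℝ => ((Real.sinh q.1 : ℝ) : ℂ) :=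
    Complex.continuous_ofReal.comp (Real.continuous_sinh.comp continuous_fst)
  have hq : Continuous fun q : ℝ × ℝ => ((invHeightDeriv q.1 q.2 / invHeight q.1 q.2 : ℝ) : ℂ) :=
    Complex.continuous_ofReal.comp continuous_invHeightDeriv_div
  unfold radialFlux
  fun_prop

theorem continuous_radialFluxDeriv (s : ℂ) :
    Continuous fun q : ℝ × ℝ => radialFluxDeriv s q.1 q.2 := by
  have hcp := continuous_heightPow s
  have hSc : Continuous fun q : ℝ × ℝ => ((Real.sinh q.1 : ℝ) : ℂ) :=
    Complex.continuous_ofReal.comp (Real.continuous_sinh.comp continuous_fst)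
  have haf := continuous_angleFluxDeriv s
  unfold radialFluxDeriv
  fun_prop

theorem integral_radialFlux (s : ℂ) (l : ℝ) :
    ∫ θ in (-Real.pi)..Real.pi, radialFlux s l θ = Real.sinh l * sphDeriv s l := by
  unfold radialFlux sphDeriv
  exact intervalIntegral.integral_const_mul _ _

theorem integral_radialFluxDeriv (s : ℂ) (l : ℝ) :
    ∫ θ in (-Real.pi)..Real.pi, radialFluxDeriv s l θ =
      -(s * (1 - s)) * Real.sinh l * sph s l := by
  have haf := continuous_of_continuous_pair (continuous_angleFluxDeriv s) l
  have hpl := continuous_of_continuous_pair (continuous_heightPow s) l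
  have e2 : ∫ θ in (-Real.pi)..Real.pi, angleFluxDeriv s l θ = 0 := by
    rw [intervalIntegral.integral_eq_sub_of_hasDerivAt (fun θ _ => hasDerivAt_angleFlux s l θ)
      (haf.intervalIntegrable _ _)]
    simp [angleFlux]
  have h3 : Continuous fun θ => -(s * (1 - s)) * Real.sinh l * heightPow s l θ :=
    continuous_const.mul hpl
  unfold radialFluxDeriv
  rw [intervalIntegral.integral_add (h3.intervalIntegrable _ _)
    (haf.intervalIntegrable _ _), intervalIntegral.integral_const_mul, e2, add_zero, sph]

/-- The spherical function is an eigenfunction of the radial Laplacian. -/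
theorem hasDerivAt_sinh_mul_sphDeriv (s : ℂ) (l : ℝ) :
    HasDerivAt (fun l => (Real.sinh l : ℂ) * sphDeriv s l)
      (-(s * (1 - s)) * Real.sinh l * sph s l) l := by
  have key := hasDerivAt_intervalIntegral_of_continuous (by linarith [Real.pi_pos])
    (continuous_radialFlux s) (continuous_radialFluxDeriv s)
    (hasDerivAt_sinh_mul_heightPow_deriv s) l (a := -Real.pi) (b := Real.pi)
  simpa only [integral_radialFlux, integral_radialFluxDeriv] using key

/-! ### Spherical functions of real parameter. -/

/-- The spherical function of real parameter, times `2π`. -/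
def sphR (σ l : ℝ) : ℝ :=
  ∫ θ in (-Real.pi)..Real.pi, Real.exp (-σ * Real.log (invHeight l θ))

theorem continuous_exp_log_invHeight (σ l : ℝ) :
    Continuous fun θ => Real.exp (-σ * Real.log (invHeight l θ)) :=
  Real.continuous_exp.comp (continuous_const.mul
    (continuous_log_invHeight.comp (Continuous.prodMk_right l)))

theorem sph_ofReal (σ l : ℝ) : sph σ l = sphR σ l := by
  rw [sph, sphR, ← intervalIntegral.integral_ofReal]
  simp [heightPow]

theorem norm_sph_le (s : ℂ) (l : ℝ) : ‖sph s l‖ ≤ sphR s.re l := by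
  refine (intervalIntegral.norm_integral_le_integral_norm (by linarith [Real.pi_pos])).trans_eq ?_
  simp only [norm_heightPow, sphR]

theorem sphR_pos (σ l : ℝ) : 0 < sphR σ l :=
  intervalIntegral.intervalIntegral_pos_of_pos
    ((continuous_exp_log_invHeight σ l).intervalIntegrable _ _) (fun _ => Real.exp_pos _)
    (by linarith [Real.pi_pos])

theorem continuous_sphR (σ : ℝ) : Continuous (sphR σ) := by
  have : sphR σ = fun l => (sph σ l).re := by
    funext l
    rw [sph_ofReal, Complex.ofReal_re]
  rw [this]
  exact Complex.continuous_re.comp (continuous_sph σ)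

theorem sphDeriv_zero_right (s : ℂ) : sphDeriv s 0 = 0 := by
  have : ∀ θ : ℝ, -s * (invHeightDeriv 0 θ / invHeight 0 θ : ℝ) * heightPow s 0 θ =
      -s * ((Real.cos θ : ℝ) : ℂ) := by
    intro θ
    simp [invHeightDeriv, invHeight, heightPow]
  simp only [sphDeriv, this]
  rw [intervalIntegral.integral_const_mul, intervalIntegral.integral_ofReal]
  simp

theorem sph_zero_right (s : ℂ) : sph s 0 = 2 * Real.pi := by
  simp [sph, heightPow, invHeight]
  ring

/-- At `s = 1` the eigenvalue vanishes, so `sinh l · φ'(l)` is constant, hence zero by its value at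
`l = 0`. -/
theorem sph_one (l : ℝ) : sph 1 l = 2 * Real.pi := by
  have h0 : ∀ l, (Real.sinh l : ℂ) * sphDeriv 1 l = 0 := by
    intro l
    have := is_const_of_deriv_eq_zero
      (fun x => (hasDerivAt_sinh_mul_sphDeriv 1 x).differentiableAt)
      (fun x => by rw [(hasDerivAt_sinh_mul_sphDeriv 1 x).deriv]; simp) l 0
    simpa using this
  have h1 : ∀ l, sphDeriv 1 l = 0 := by
    intro l
    by_cases hl : l = 0
    · rw [hl, sphDeriv_zero_right]
    · have : (Real.sinh l : ℂ) ≠ 0 := by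
        exact_mod_cast (Real.sinh_eq_zero.not.2 hl)
      exact (mul_eq_zero.1 (h0 l)).resolve_left this
  rw [← sph_zero_right 1]
  exact is_const_of_deriv_eq_zero (fun x => (hasDerivAt_sph 1 x).differentiableAt)
    (fun x => by rw [(hasDerivAt_sph 1 x).deriv, h1]) l 0

theorem sphR_one (l : ℝ) : sphR 1 l = 2 * Real.pi := by
  have := sph_one l
  have h := sph_ofReal 1 l
  rw [Complex.ofReal_one, this] at h
  exact_mod_cast h.symm

theorem sphR_zero (l : ℝ) : sphR 0 l = 2 * Real.pi := by
  simp [sphR]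
  ring

/-- Lifts a pointwise inequality between powers of `p` to the circle integrals; it replaces Hölder's
inequality. -/
theorem sphR_mono_combination {σ a b α β l : ℝ}
    (h : ∀ p : ℝ, 0 < p → Real.exp (-σ * Real.log p) ≤
      a * Real.exp (-α * Real.log p) + b * Real.exp (-β * Real.log p)) :
    sphR σ l ≤ a * sphR α l + b * sphR β l := by
  have ha := (continuous_exp_log_invHeight α l).const_mul a
  have hb := (continuous_exp_log_invHeight β l).const_mul b
  unfold sphR
  rw [← intervalIntegral.integral_const_mul, ← intervalIntegral.integral_const_mul,
    ← intervalIntegral.integral_add (ha.intervalIntegrable _ _) (hb.intervalIntegrable _ _)]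
  exact intervalIntegral.integral_mono (by linarith [Real.pi_pos])
    ((continuous_exp_log_invHeight σ l).intervalIntegrable _ _)
    ((ha.add hb).intervalIntegrable _ _) fun θ => h _ (invHeight_pos l θ)

theorem sphR_half_le (l : ℝ) : sphR (1 / 2) l ≤ 2 * Real.pi := by
  have h : sphR (1 / 2) l ≤ 1 / 2 * sphR 0 l + 1 / 2 * sphR 1 l := by
    refine sphR_mono_combination fun p hp => ?_
    have e : Real.exp (-1 * Real.log p) = Real.exp (-(1 / 2) * Real.log p) ^ 2 := by
      rw [← Real.exp_nat_mul]
      push_cast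
      congr 1
      ring
    rw [e]
    simp only [neg_zero, zero_mul, Real.exp_zero]
    nlinarith [sq_nonneg (Real.exp (-(1 / 2) * Real.log p) - 1)]
  rw [sphR_zero, sphR_one] at h
  linarith

/-- The radial derivative of `sphR`. -/
def sphRDeriv (σ l : ℝ) : ℝ := (sphDeriv σ l).re

theorem hasDerivAt_sphR (σ l : ℝ) : HasDerivAt (sphR σ) (sphRDeriv σ l) l := by
  have h := Complex.reCLM.hasFDerivAt.comp_hasDerivAt l (hasDerivAt_sph σ l)
  refine h.congr_of_eventuallyEq (Filter.Eventually.of_forall fun x => ?_)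
  simp [sph_ofReal]

theorem hasDerivAt_sinh_mul_sphRDeriv (σ l : ℝ) :
    HasDerivAt (fun l => Real.sinh l * sphRDeriv σ l)
      (-(σ * (1 - σ)) * Real.sinh l * sphR σ l) l := by
  have h := Complex.reCLM.hasFDerivAt.comp_hasDerivAt l (hasDerivAt_sinh_mul_sphDeriv σ l)
  have e : Complex.reCLM (-((σ : ℂ) * (1 - σ)) * Real.sinh l * sph σ l) =
      -(σ * (1 - σ)) * Real.sinh l * sphR σ l := by
    rw [sph_ofReal]
    norm_cast
  rw [e] at h
  refine h.congr_of_eventuallyEq (Filter.Eventually.of_forall fun x => ?_)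
  simp [sphRDeriv, -Complex.ofReal_sinh]

/-- The decay of the ground spherical function. -/
theorem sphR_half_le_cosh {l : ℝ} (hl : 0 ≤ l) :
    sphR (1 / 2) l ≤ 2 * Real.pi / Real.sqrt (Real.cosh (l / 2)) := by
  set u := sphR (1 / 2) with hu
  set u' := sphRDeriv (1 / 2) with hu'
  have hd : ∀ x, HasDerivAt u (u' x) x := hasDerivAt_sphR _
  have hv : ∀ x, HasDerivAt (fun x => Real.sinh x * u' x) (-(1 / 4) * Real.sinh x * u x) x := by
    intro x
    refine (hasDerivAt_sinh_mul_sphRDeriv (1 / 2) x).congr_deriv ?_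
    ring
  have hpos : ∀ x, 0 < u x := sphR_pos _
  -- The equation and `u > 0` make `sinh · u'` decreasing from `0`, so `u` decreases. Reinserting
  -- this monotonicity into the integrated equation gives `u' / u ≤ -(1/4) tanh(x/2)`, which is
  -- `hstrong`.
  have hneg : ∀ x, 0 ≤ x → Real.sinh x * u' x ≤ 0 := by
    intro x hx
    have := sub_le_sub_of_hasDerivAt_le (g := fun x => Real.sinh x * u' x) (B := fun _ => (0 : ℝ))
      (B' := fun _ => 0) hx
      (fun y _ => (hv y).continuousAt.continuousWithinAt) continuousOn_const
      (fun y _ => hv y) (fun y _ => hasDerivAt_const _ _) (fun y hy => by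
        have h1 := Real.sinh_pos_iff.2 hy.1
        have h2 := mul_pos h1 (hpos y)
        nlinarith)
    simpa using this
  have hanti : ∀ x y, 0 ≤ x → x ≤ y → u y ≤ u x := by
    intro x y hx hxy
    have := sub_le_sub_of_hasDerivAt_le (g := u) (B := fun _ => (0 : ℝ))
      (B' := fun _ => 0) hxy (continuous_sphR _).continuousOn continuousOn_const
      (fun y _ => hd y) (fun y _ => hasDerivAt_const _ _) (fun z hz => by
        have h1 := Real.sinh_pos_iff.2 (hx.trans_lt hz.1)
        exact nonpos_of_mul_nonpos_right (hneg z (hx.trans hz.1.le)) h1)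
    simpa using this
  have hstrong : ∀ x, 0 ≤ x → Real.sinh x * u' x ≤ -(1 / 4) * u x * (Real.cosh x - 1) := by
    intro x hx
    have := sub_le_sub_of_hasDerivAt_le (g := fun x => Real.sinh x * u' x)
      (B := fun y => -(1 / 4) * u x * Real.cosh y)
      (B' := fun y => -(1 / 4) * u x * Real.sinh y) hx
      (fun y _ => (hv y).continuousAt.continuousWithinAt) (by fun_prop)
      (fun y _ => hv y) (fun y _ => (Real.hasDerivAt_cosh y).const_mul _) (fun y hy => by
        have h1 := Real.sinh_pos_iff.2 hy.1
        have h2 := mul_le_mul_of_nonneg_left (hanti y x hy.1.le hy.2.le) h1.le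
        nlinarith)
    simp only [Real.sinh_zero, zero_mul, sub_zero, Real.cosh_zero] at this
    linarith
  have hc : ∀ x : ℝ, HasDerivAt (fun x : ℝ => Real.cosh (x / 2)) (Real.sinh (x / 2) * (1 / 2)) x :=
    fun x => ((hasDerivAt_id x).div_const 2).cosh
  -- By `hstrong`, `u² cosh(x/2)` has nonpositive logarithmic derivative `2u'/u + tanh(x/2)/2`.
  have hfin : u l ^ 2 * Real.cosh (l / 2) ≤ (2 * Real.pi) ^ 2 := by
    have := sub_le_sub_of_hasDerivAt_le (g := fun x => u x ^ 2 * Real.cosh (x / 2))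
      (B := fun _ => (0 : ℝ)) (B' := fun _ => 0) hl
      (by
        have := continuous_sphR (1 / 2)
        fun_prop) continuousOn_const
      (fun y _ => ((hd y).pow 2).mul (hc y)) (fun y _ => hasDerivAt_const _ _) (fun x hx => by
        have hs := Real.sinh_pos_iff.2 (half_pos hx.1)
        have hch := Real.cosh_pos (x / 2)
        have h1 := hstrong x hx.1.le
        have e1 : Real.sinh x = 2 * Real.sinh (x / 2) * Real.cosh (x / 2) := by
          rw [← Real.sinh_two_mul]; congr 1; ring
        have e2 : Real.cosh x = 2 * Real.sinh (x / 2) ^ 2 + 1 := by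
          have : Real.cosh x = Real.cosh (2 * (x / 2)) := by congr 1; ring
          rw [this, Real.cosh_two_mul, Real.cosh_sq]; ring
        rw [e1, e2] at h1
        have h2 : 2 * Real.cosh (x / 2) * u' x + u x * Real.sinh (x / 2) * (1 / 2) ≤ 0 := by
          refine nonpos_of_mul_nonpos_right ?_ hs
          nlinarith
        have h3 := mul_nonpos_of_nonneg_of_nonpos (hpos x).le h2
        simp only [Pi.pow_apply]
        norm_num
        nlinarith)
    have h0 : u 0 = 2 * Real.pi := by
      have h := sph_ofReal (1 / 2) 0
      rw [sph_zero_right] at h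
      exact_mod_cast h.symm
    simp only [h0, sub_self, zero_div, Real.cosh_zero, mul_one] at this
    linarith
  have hch := Real.cosh_pos (l / 2)
  rw [le_div_iff₀ (Real.sqrt_pos.2 hch)]
  refine abs_le_of_sq_le_sq' ?_ (by positivity) |>.2
  rw [mul_pow, Real.sq_sqrt hch.le]
  exact hfin

/-! ### Energy estimate for the radial equation. -/

theorem cosh_le_one_add_sq {x : ℝ} (h0 : 0 ≤ x) (h1 : x ≤ 1) : Real.cosh x ≤ 1 + x ^ 2 := by
  have h := Real.cosh_le_exp_half_sq x
  have h2 := Real.abs_exp_sub_one_le (x := x ^ 2 / 2) (by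
    rw [abs_of_nonneg (by positivity)]; nlinarith)
  rw [abs_of_nonneg (a := x ^ 2 / 2) (by positivity)] at h2
  have := (abs_le.1 h2).2
  linarith

theorem sinh_le_two_mul {x : ℝ} (h0 : 0 ≤ x) (h1 : x ≤ 1) : Real.sinh x ≤ 2 * x := by
  have := sub_le_sub_of_hasDerivAt_le (g := Real.sinh) (B := fun y => 2 * y) (B' := fun _ => 2) h0
    Real.continuous_sinh.continuousOn (by fun_prop) (fun y _ => Real.hasDerivAt_sinh y)
    (fun y _ => by simpa using (hasDerivAt_id y).const_mul 2) (fun y hy => by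
      have := cosh_le_one_add_sq hy.1.le (hy.2.le.trans h1)
      nlinarith [hy.1, hy.2])
  simpa using this

section Energy

variable {u u' : ℝ → ℝ} {M t : ℝ}

/-- The energy of a solution of the radial eigenvalue equation for the eigenvalue `1/4 + t²`. -/
def radialEnergy (u u' : ℝ → ℝ) (t l : ℝ) : ℝ :=
  ((Real.sinh l * u' l) ^ 2 + Real.cosh l * (Real.sinh l * u' l) * u l +
    (Real.cosh l ^ 2 + 1) / 4 * u l ^ 2) / Real.sinh l + t ^ 2 * Real.sinh l * u l ^ 2

/-- In Liouville normal form `w = √(sinh l) u` satisfies `w'' + q w = 0` with `q = t² + 1/(4 sinh²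
l)`. The energy is `w'² + q w²`, whose derivative `q' w²` is nonpositive because `q` decreases. -/
theorem hasDerivAt_radialEnergy (hu : ∀ l, HasDerivAt u (u' l) l)
    (hv : ∀ l, HasDerivAt (fun l => Real.sinh l * u' l)
      (-(1 / 4 + t ^ 2) * Real.sinh l * u l) l) {l : ℝ} (hl : 0 < l) :
    HasDerivAt (radialEnergy u u' t)
      (-(Real.cosh l * u l ^ 2 / (2 * Real.sinh l ^ 2))) l := by
  have hs : Real.sinh l ≠ 0 := (Real.sinh_pos_iff.2 hl).ne'
  have hS := Real.hasDerivAt_sinh l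
  have hC := Real.hasDerivAt_cosh l
  have h := ((((hv l).pow 2).add ((hC.mul (hv l)).mul (hu l))).add
    ((((hC.pow 2).add_const 1).div_const 4).mul ((hu l).pow 2))).div hS hs
  have h' := h.add ((hS.const_mul (t ^ 2)).mul ((hu l).pow 2))
  refine h'.congr_deriv ?_
  have hc : Real.cosh l ^ 2 = Real.sinh l ^ 2 + 1 := Real.cosh_sq l
  simp only [Pi.mul_apply, Pi.add_apply, Pi.pow_apply]
  generalize Real.sinh l = S at *
  generalize Real.cosh l = c at *
  generalize u l = a at *
  generalize u' l = b at *
  field_simp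
  have hc3 : c ^ 3 = c * (S ^ 2 + 1) := by rw [← hc]; ring
  ring_nf
  simp only [hc, hc3]
  ring

/-- Initial value for the energy at the radius `1/t`, where the oscillation sets in: there `sinh l`
is between `1/t` and `2/t`, and the flux `sinh l · u'` is still `O(M)`. -/
theorem radialEnergy_inv_le (ht : 1 ≤ t) (hv : ∀ l, HasDerivAt (fun l => Real.sinh l * u' l)
      (-(1 / 4 + t ^ 2) * Real.sinh l * u l) l) (hb : ∀ l, |u l| ≤ M) :
    radialEnergy u u' t (1 / t) ≤ 8 * M ^ 2 * t := by
  have ht0 : 0 < t := by linarith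
  have hM : 0 ≤ M := (abs_nonneg _).trans (hb 0)
  set x := 1 / t with hx
  have hx0 : 0 < x := by positivity
  have hx1 : x ≤ 1 := by rw [hx, div_le_one ht0]; exact ht
  have htx : t * x = 1 := by rw [hx]; field_simp
  have hC := cosh_le_one_add_sq hx0.le hx1
  have hS1 : x ≤ Real.sinh x := Real.self_le_sinh_iff.2 hx0.le
  have hS2 := sinh_le_two_mul hx0.le hx1
  have hC1 := Real.one_le_cosh x
  -- Integrating the equation from `0`: `(1/4 + t²)(cosh x - 1) ≤ x²/4 + (t x)² ≤ 5/4`. The factor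
  -- `ε` is used at `±1`, to bound both signs at once.
  have hv1 : |Real.sinh x * u' x| ≤ 5 / 4 * M := by
    have hle : ∀ ε : ℝ, |ε| ≤ 1 → ε * (Real.sinh x * u' x) ≤ 5 / 4 * M := by
      intro ε hε
      have := sub_le_sub_of_hasDerivAt_le (g := fun y => ε * (Real.sinh y * u' y))
        (B := fun y => (1 / 4 + t ^ 2) * M * Real.cosh y)
        (B' := fun y => (1 / 4 + t ^ 2) * M * Real.sinh y) hx0.le
        (fun y _ => ((hv y).const_mul ε).continuousAt.continuousWithinAt) (by fun_prop)
        (fun y _ => (hv y).const_mul ε) (fun y _ => (Real.hasDerivAt_cosh y).const_mul _)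
        (fun y hy => by
          have hs := Real.sinh_pos_iff.2 hy.1
          have h1 : -(ε * u y) ≤ M := by
            refine (neg_le_abs _).trans ?_
            rw [abs_mul]
            nlinarith [hb y, abs_nonneg (u y), abs_nonneg ε]
          have h2 : 0 ≤ (1 / 4 + t ^ 2) * Real.sinh y := by positivity
          nlinarith [mul_le_mul_of_nonneg_left h1 h2])
      simp only [Real.sinh_zero, zero_mul, mul_zero, sub_zero, Real.cosh_zero, mul_one] at this
      have h3 : (1 / 4 + t ^ 2) * M * (Real.cosh x - 1) ≤ (1 / 4 + t ^ 2) * M * x ^ 2 := by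
        gcongr
        linarith
      have h4 : (1 / 4 + t ^ 2) * M * x ^ 2 = (x ^ 2 / 4 + (t * x) ^ 2) * M := by ring
      rw [htx] at h4
      have h5 : x ^ 2 * M ≤ 1 * M := by
        gcongr
        nlinarith
      linarith
    exact abs_le.2 ⟨by linarith [hle (-1) (by simp)], by linarith [hle 1 (by simp)]⟩
  have hu1 := hb x
  unfold radialEnergy
  generalize Real.sinh x * u' x = v at *
  generalize u x = a at *
  generalize Real.sinh x = S at *
  generalize Real.cosh x = c at *
  have hS0 : 0 < S := hx0.trans_le hS1
  have hc2 : c ≤ 2 := by nlinarith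
  have e1 : v ^ 2 ≤ (5 / 4 * M) ^ 2 := sq_le_sq' (abs_le.1 hv1).1 (abs_le.1 hv1).2
  have e2 : a ^ 2 ≤ M ^ 2 := sq_le_sq' (abs_le.1 hu1).1 (abs_le.1 hu1).2
  have e3 : c * v * a ≤ 2 * (5 / 4 * M) * M := by
    refine (le_abs_self _).trans ?_
    rw [abs_mul, abs_mul, abs_of_pos (by linarith : 0 < c)]
    gcongr
  have e4 : (c ^ 2 + 1) / 4 * a ^ 2 ≤ (2 ^ 2 + 1) / 4 * M ^ 2 := by gcongr
  have e5 : (v ^ 2 + c * v * a + (c ^ 2 + 1) / 4 * a ^ 2) / S ≤ 6 * M ^ 2 * t := by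
    rw [div_le_iff₀ hS0]
    have : 1 ≤ t * S := by rw [← htx]; gcongr
    nlinarith [mul_le_mul_of_nonneg_left this (by positivity : 0 ≤ 6 * M ^ 2)]
  have e6 : t ^ 2 * S * a ^ 2 ≤ 2 * M ^ 2 * t := by
    have : t * S ≤ 2 := by nlinarith
    calc t ^ 2 * S * a ^ 2 = t * (t * S) * a ^ 2 := by ring
      _ ≤ t * 2 * M ^ 2 := by gcongr
      _ = _ := by ring
  linarith

/-- Solutions of the radial eigenvalue equation decay like `(t sinh l)^(-1/2)`. -/
theorem radial_solution_bounds (ht : 1 ≤ t) (hu : ∀ l, HasDerivAt u (u' l) l)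
    (hv : ∀ l, HasDerivAt (fun l => Real.sinh l * u' l)
      (-(1 / 4 + t ^ 2) * Real.sinh l * u l) l) (hb : ∀ l, |u l| ≤ M) {l : ℝ} (hl : 1 / t ≤ l) :
    t * Real.sinh l * u l ^ 2 ≤ 8 * M ^ 2 ∧ Real.sinh l * u' l ^ 2 ≤ 36 * M ^ 2 * t := by
  have ht0 : 0 < t := by linarith
  have hx0 : 0 < 1 / t := by positivity
  have hl0 : 0 < l := hx0.trans_le hl
  have hE : radialEnergy u u' t l ≤ 8 * M ^ 2 * t := by
    have := sub_le_sub_of_hasDerivAt_le (g := radialEnergy u u' t) (B := fun _ => (0 : ℝ))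
      (B' := fun _ => 0) hl
      (fun y hy => (hasDerivAt_radialEnergy hu hv
        (hx0.trans_le hy.1)).continuousAt.continuousWithinAt) continuousOn_const
      (fun y hy => hasDerivAt_radialEnergy hu hv (hx0.trans hy.1))
      (fun y _ => hasDerivAt_const _ _) (fun y hy => by
        have := Real.cosh_pos y
        exact neg_nonpos.2 (by positivity))
    have h2 := radialEnergy_inv_le ht hv hb
    simp only [sub_self] at this
    linarith
  have hS : 1 / t ≤ Real.sinh l := hl.trans (Real.self_le_sinh_iff.2 hl0.le)
  have htS : 1 ≤ t * Real.sinh l := by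
    rw [div_le_iff₀ ht0] at hS
    linarith
  have hS0 : 0 < Real.sinh l := hx0.trans_le hS
  have hc := Real.cosh_sq l
  unfold radialEnergy at hE
  -- Completing the square exhibits the energy as a sum of nonnegative terms, so each is bounded by
  -- the whole.
  have e1 : ((Real.sinh l * u' l + Real.cosh l * u l / 2) ^ 2 + u l ^ 2 / 4) / Real.sinh l +
      t ^ 2 * Real.sinh l * u l ^ 2 ≤ 8 * M ^ 2 * t := by
    refine le_trans (le_of_eq ?_) hE
    field_simp
    ring
  generalize Real.sinh l = S at *
  generalize Real.cosh l = c at *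
  generalize u l = a at *
  generalize u' l = b at *
  have f1 : t * S * a ^ 2 ≤ 8 * M ^ 2 := by
    have h1 : 0 ≤ ((S * b + c * a / 2) ^ 2 + a ^ 2 / 4) / S := by positivity
    have h2 : t ^ 2 * S * a ^ 2 = t * (t * S * a ^ 2) := by ring
    exact le_of_mul_le_mul_left (by linarith) ht0
  refine ⟨f1, ?_⟩
  have f2 : (S * b + c * a / 2) ^ 2 ≤ 8 * M ^ 2 * t * S := by
    have h1 : 0 ≤ t ^ 2 * S * a ^ 2 := by positivity
    have h2 : ((S * b + c * a / 2) ^ 2 + a ^ 2 / 4) / S ≤ 8 * M ^ 2 * t := by linarith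
    have h3 := (div_le_iff₀ hS0).1 h2
    nlinarith [sq_nonneg a]
  have f3 : c ^ 2 * a ^ 2 ≤ 16 * M ^ 2 * t * S := by
    have h1 : a ^ 2 ≤ 8 * M ^ 2 := by nlinarith [mul_le_mul_of_nonneg_right htS (sq_nonneg a)]
    have h2 : a ^ 2 ≤ 8 * M ^ 2 * (t * S) :=
      h1.trans (le_mul_of_one_le_right (by positivity) htS)
    have h3 : S * a ^ 2 ≤ 8 * M ^ 2 := by
      refine le_trans ?_ f1
      rw [mul_assoc]
      exact le_mul_of_one_le_left (by positivity) ht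
    have h4 : S * (S * a ^ 2) ≤ 8 * M ^ 2 * (t * S) :=
      calc S * (S * a ^ 2) ≤ S * (8 * M ^ 2) := by gcongr
        _ = 8 * M ^ 2 * (1 * S) := by ring
        _ ≤ 8 * M ^ 2 * (t * S) := by gcongr
    rw [hc]
    linarith
  have f4 : (S * b) ^ 2 ≤ 36 * M ^ 2 * t * S := by
    nlinarith [sq_nonneg (S * b + c * a / 2 + c * a / 2)]
  have : S * (S * b ^ 2) ≤ S * (36 * M ^ 2 * t) := by linarith
  exact le_of_mul_le_mul_left this hS0

end Energy

/-! ### The profile `pairF`: its three pieces, their derivatives, and size bounds. -/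

/-- The square root in the definition of `pairF`. -/
def rootR (X l : ℝ) : ℝ := Real.sqrt (Real.sinh l ^ 2 - X ^ 2)

/-- The radius at which `sinh l = X`. -/
def lowerRadius (X : ℝ) : ℝ := Real.arsinh X

/-- The radius at which `2 sinh (l / 2) = X`. -/
def upperRadius (X : ℝ) : ℝ := 2 * Real.arsinh (X / 2)

theorem lowerRadius_le_iff {X l : ℝ} : lowerRadius X ≤ l ↔ X ≤ Real.sinh l := by
  rw [lowerRadius, ← Real.sinh_le_sinh, Real.sinh_arsinh]

theorem upperRadius_le_iff {X l : ℝ} : upperRadius X ≤ l ↔ X ≤ 2 * Real.sinh (l / 2) := by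
  have h : upperRadius X ≤ l ↔ Real.arsinh (X / 2) ≤ l / 2 := by
    rw [upperRadius]
    constructor <;> intro h <;> linarith
  rw [h, ← Real.sinh_le_sinh, Real.sinh_arsinh]
  constructor <;> intro h <;> linarith

theorem sinh_lowerRadius (X : ℝ) : Real.sinh (lowerRadius X) = X := Real.sinh_arsinh X

theorem sinh_half_eq {l : ℝ} : Real.sinh l = 2 * Real.sinh (l / 2) * Real.cosh (l / 2) := by
  rw [← Real.sinh_two_mul]; congr 1; ring

theorem cosh_half_eq {l : ℝ} : Real.cosh l = 2 * Real.sinh (l / 2) ^ 2 + 1 := by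
  have : Real.cosh l = Real.cosh (2 * (l / 2)) := by congr 1; ring
  rw [this, Real.cosh_two_mul, Real.cosh_sq]; ring

theorem sinh_upperRadius_half (X : ℝ) : Real.sinh (upperRadius X / 2) = X / 2 := by
  rw [upperRadius, mul_div_cancel_left₀ _ two_ne_zero, Real.sinh_arsinh]

theorem cosh_upperRadius (X : ℝ) : Real.cosh (upperRadius X) = 1 + X ^ 2 / 2 := by
  rw [cosh_half_eq, sinh_upperRadius_half]
  ring

theorem sinh_sq_upperRadius (X : ℝ) : Real.sinh (upperRadius X) ^ 2 = X ^ 2 + (X ^ 2 / 2) ^ 2 := by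
  rw [Real.sinh_sq, cosh_upperRadius]
  ring

theorem rootR_upperRadius (X : ℝ) : rootR X (upperRadius X) = X ^ 2 / 2 := by
  rw [rootR, sinh_sq_upperRadius, add_sub_cancel_left, Real.sqrt_sq (by positivity)]

theorem rootR_lowerRadius (X : ℝ) : rootR X (lowerRadius X) = 0 := by
  rw [rootR, sinh_lowerRadius, sub_self, Real.sqrt_zero]

theorem rootR_nonneg (X l : ℝ) : 0 ≤ rootR X l := Real.sqrt_nonneg _

theorem continuous_rootR (X : ℝ) : Continuous (rootR X) := by
  unfold rootR
  fun_prop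

theorem cosh_add_rootR_pos (X l : ℝ) : 0 < Real.cosh l + rootR X l :=
  add_pos_of_pos_of_nonneg (Real.cosh_pos l) (rootR_nonneg X l)

theorem lowerRadius_pos {X : ℝ} (hX : 0 < X) : 0 < lowerRadius X := Real.arsinh_pos_iff.2 hX

theorem lowerRadius_lt_upperRadius {X : ℝ} (hX : 0 < X) : lowerRadius X < upperRadius X := by
  rw [← Real.sinh_lt_sinh, sinh_lowerRadius]
  have h1 := sinh_sq_upperRadius X
  have h2 : 0 < upperRadius X := mul_pos two_pos (Real.arsinh_pos_iff.2 (half_pos hX))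
  have h3 := Real.sinh_pos_iff.2 h2
  refine lt_of_pow_lt_pow_left₀ 2 h3.le ?_
  rw [h1]
  have : 0 < (X ^ 2 / 2) ^ 2 := by positivity
  linarith

theorem upperRadius_pos {X : ℝ} (hX : 0 < X) : 0 < upperRadius X :=
  (lowerRadius_pos hX).trans (lowerRadius_lt_upperRadius hX)

theorem rootR_sq {X l : ℝ} (hX : 0 < X) (hl : lowerRadius X ≤ l) :
    rootR X l ^ 2 = Real.sinh l ^ 2 - X ^ 2 := by
  have h := lowerRadius_le_iff.1 hl
  exact Real.sq_sqrt (by nlinarith)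

theorem rootR_pos {X l : ℝ} (hX : 0 < X) (hl : lowerRadius X < l) : 0 < rootR X l := by
  have h : X < Real.sinh l := by rwa [← sinh_lowerRadius X, Real.sinh_lt_sinh]
  exact Real.sqrt_pos.2 (by nlinarith)

theorem rootR_le_sinh {X l : ℝ} (hl : 0 ≤ l) : rootR X l ≤ Real.sinh l := by
  refine Real.sqrt_le_iff.2 ⟨Real.sinh_nonneg_iff.2 hl, ?_⟩
  nlinarith [sq_nonneg X]

theorem rootR_mono {X l l' : ℝ} (h0 : 0 ≤ l) (h : l ≤ l') : rootR X l ≤ rootR X l' := by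
  refine Real.sqrt_le_sqrt ?_
  have h1 := Real.sinh_nonneg_iff.2 h0
  have h2 := Real.sinh_le_sinh.2 h
  nlinarith

theorem hasDerivAt_rootR {X l : ℝ} (hX : 0 < X) (hl : lowerRadius X < l) :
    HasDerivAt (rootR X) (Real.sinh l * Real.cosh l / rootR X l) l := by
  have h := rootR_pos hX hl
  have h0 : Real.sinh l ^ 2 - X ^ 2 ≠ 0 := (Real.sqrt_pos.1 h).ne'
  have := ((((Real.hasDerivAt_sinh l).pow 2).sub_const (X ^ 2)).sqrt h0)
  refine this.congr_deriv ?_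
  change _ / (2 * rootR X l) = _
  norm_num
  field_simp

theorem hasDerivAt_log_cosh_add_rootR {X l : ℝ} (hX : 0 < X) (hl : lowerRadius X < l) :
    HasDerivAt (fun l => Real.log (Real.cosh l + rootR X l)) (Real.sinh l / rootR X l) l := by
  have h := rootR_pos hX hl
  have hp := cosh_add_rootR_pos X l
  refine (((Real.hasDerivAt_cosh l).add (hasDerivAt_rootR hX hl)).log hp.ne').congr_deriv ?_
  rw [Pi.add_apply, div_eq_div_iff hp.ne' h.ne']
  field_simp
  ring

theorem pairF_of_upperRadius_le {X l : ℝ} (hl : upperRadius X ≤ l) :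
    pairF X l = l - Real.log (Real.cosh l + rootR X l) := by
  rw [pairF, if_pos (upperRadius_le_iff.1 hl), ← rootR, Real.cosh_add_sinh,
    Real.log_div (Real.exp_pos _).ne' (cosh_add_rootR_pos X l).ne', Real.log_exp]

theorem log_middle_eq (X l : ℝ) :
    Real.log ((Real.cosh l + Real.sinh l) * (1 + X ^ 2) /
      (Real.cosh l + Real.sqrt (Real.sinh l ^ 2 - X ^ 2)) ^ 2) =
        l + Real.log (1 + X ^ 2) - 2 * Real.log (Real.cosh l + rootR X l) := by
  have hX : 0 < 1 + X ^ 2 := by positivity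
  rw [← rootR, Real.cosh_add_sinh, Real.log_div (by positivity)
    (pow_ne_zero 2 (cosh_add_rootR_pos X l).ne'), Real.log_mul (by positivity) hX.ne',
    Real.log_exp, Real.log_pow]
  norm_num

/-- Stated on the closed interval. At `upperRadius` the two formulas agree because there `cosh l + R
= (1 + X²/2) + X²/2 = 1 + X²`, where `R` is the square root `rootR`. -/
theorem pairF_of_middle {X l : ℝ} (hl : lowerRadius X ≤ l) (hl' : l ≤ upperRadius X) :
    pairF X l = l + Real.log (1 + X ^ 2) - 2 * Real.log (Real.cosh l + rootR X l) := by
  rcases hl'.eq_or_lt with h | h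
  · rw [pairF_of_upperRadius_le h.ge, h, cosh_upperRadius, rootR_upperRadius]
    have : 1 + X ^ 2 / 2 + X ^ 2 / 2 = 1 + X ^ 2 := by ring
    rw [this]
    ring
  · rw [pairF, if_neg (fun h' => h.not_ge (upperRadius_le_iff.2 h')),
      if_pos (lowerRadius_le_iff.1 hl), log_middle_eq]

theorem pairF_of_le_lowerRadius {X l : ℝ} (hX : 0 < X) (hl : l ≤ lowerRadius X) :
    pairF X l = l := by
  rcases hl.eq_or_lt with h | h
  · rw [pairF_of_middle h.ge (hl.trans (lowerRadius_lt_upperRadius hX).le), h, rootR_lowerRadius,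
      add_zero]
    have h1 : Real.cosh (lowerRadius X) ^ 2 = 1 + X ^ 2 := by
      rw [Real.cosh_sq, sinh_lowerRadius]; ring
    rw [← h1, Real.log_pow]
    push_cast
    ring
  · rw [pairF, if_neg (fun h' => (h.trans (lowerRadius_lt_upperRadius hX)).not_ge
      (upperRadius_le_iff.2 h')), if_neg fun h' => h.not_ge (lowerRadius_le_iff.2 h')]

theorem continuous_log_cosh_add_rootR (X : ℝ) :
    Continuous fun l => Real.log (Real.cosh l + rootR X l) :=
  (Real.continuous_cosh.add (continuous_rootR X)).log fun l => (cosh_add_rootR_pos X l).ne'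

theorem continuous_pairF {X : ℝ} (hX : 0 < X) : Continuous (pairF X) := by
  have hlog := continuous_log_cosh_add_rootR X
  have h12 := lowerRadius_lt_upperRadius hX
  have e : pairF X = fun l => if l ≤ upperRadius X then
      (if l ≤ lowerRadius X then l else
        l + Real.log (1 + X ^ 2) - 2 * Real.log (Real.cosh l + rootR X l))
      else l - Real.log (Real.cosh l + rootR X l) := by
    funext l
    split_ifs with h1 h2
    · exact pairF_of_le_lowerRadius hX h2
    · exact pairF_of_middle (not_le.1 h2).le h1
    · exact pairF_of_upperRadius_le (not_le.1 h1).le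
  rw [e]
  refine Continuous.if_le (Continuous.if_le continuous_id' (by fun_prop) continuous_id'
    continuous_const ?_) (by fun_prop) continuous_id' continuous_const ?_
  · rintro l rfl
    rw [← pairF_of_middle le_rfl h12.le, pairF_of_le_lowerRadius hX le_rfl]
  · rintro l rfl
    rw [if_neg (not_le.2 h12), ← pairF_of_middle h12.le le_rfl, pairF_of_upperRadius_le le_rfl]

theorem hasDerivAt_pairF_low {X l : ℝ} (hX : 0 < X) (hl : l < lowerRadius X) :
    HasDerivAt (pairF X) 1 l := by
  refine (hasDerivAt_id l).congr_of_eventuallyEq ?_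
  filter_upwards [Iio_mem_nhds hl] with x hx
  exact pairF_of_le_lowerRadius hX (Set.mem_Iio.1 hx).le

theorem hasDerivAt_pairF_middle {X l : ℝ} (hX : 0 < X) (hl : lowerRadius X < l)
    (hl' : l < upperRadius X) :
    HasDerivAt (pairF X) (1 - 2 * (Real.sinh l / rootR X l)) l := by
  have h : HasDerivAt (fun l => l + Real.log (1 + X ^ 2) -
      2 * Real.log (Real.cosh l + rootR X l)) (1 - 2 * (Real.sinh l / rootR X l)) l :=
    ((hasDerivAt_id l).add_const _).sub ((hasDerivAt_log_cosh_add_rootR hX hl).const_mul 2)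
  refine h.congr_of_eventuallyEq ?_
  filter_upwards [Ioo_mem_nhds hl hl'] with x hx
  exact pairF_of_middle hx.1.le hx.2.le

theorem hasDerivAt_pairF_high {X l : ℝ} (hX : 0 < X) (hl : upperRadius X < l) :
    HasDerivAt (pairF X) (1 - Real.sinh l / rootR X l) l := by
  have h : HasDerivAt (fun l => l - Real.log (Real.cosh l + rootR X l))
      (1 - Real.sinh l / rootR X l) l :=
    (hasDerivAt_id l).sub
      (hasDerivAt_log_cosh_add_rootR hX ((lowerRadius_lt_upperRadius hX).trans hl))
  refine h.congr_of_eventuallyEq ?_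
  filter_upwards [Ioi_mem_nhds hl] with x hx
  exact pairF_of_upperRadius_le (Set.mem_Ioi.1 hx).le

theorem log_cosh_add_rootR_le {X l : ℝ} (hl : 0 ≤ l) :
    Real.log (Real.cosh l + rootR X l) ≤ l := by
  rw [Real.log_le_iff_le_exp (cosh_add_rootR_pos X l), ← Real.cosh_add_sinh]
  linarith [rootR_le_sinh (X := X) hl]

theorem pairF_nonneg {X l : ℝ} (hX : 0 < X) (hl : 0 ≤ l) : 0 ≤ pairF X l := by
  rcases le_total l (lowerRadius X) with h1 | h1
  · rwa [pairF_of_le_lowerRadius hX h1]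
  rcases le_total l (upperRadius X) with h2 | h2
  · rw [pairF_of_middle h1 h2]
    have h3 := log_cosh_add_rootR_le (X := X) hl
    have h4 : Real.log (Real.cosh l + rootR X l) ≤ Real.log (1 + X ^ 2) := by
      refine Real.log_le_log (cosh_add_rootR_pos X l) ?_
      have h5 := rootR_mono (X := X) hl h2
      have h6 : Real.cosh l ≤ Real.cosh (upperRadius X) :=
        Real.cosh_le_cosh.2 (by rw [abs_of_nonneg hl, abs_of_pos (upperRadius_pos hX)]; exact h2)
      rw [rootR_upperRadius] at h5
      rw [cosh_upperRadius] at h6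
      linarith
    linarith
  · rw [pairF_of_upperRadius_le h2]
    linarith [log_cosh_add_rootR_le (X := X) hl]

/-- From `log y ≤ y - 1` at `y = e^l / (cosh l + R)`, together with `(sinh l - R)(sinh l + R) = X²`.
-/
theorem pairF_mul_sinh_le {X l : ℝ} (hX : 0 < X) (hl : upperRadius X ≤ l) :
    pairF X l * Real.sinh l ≤ X ^ 2 / Real.cosh l := by
  have h12 := lowerRadius_lt_upperRadius hX
  have hl0 := (upperRadius_pos hX).trans_le hl
  have hp := cosh_add_rootR_pos X l
  have hR := rootR_nonneg X l
  have hRS := rootR_le_sinh (X := X) hl0.le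
  have hR2 := rootR_sq hX (h12.le.trans hl)
  have hS := Real.sinh_pos_iff.2 hl0
  have hc := Real.cosh_pos l
  have h1 : pairF X l ≤ (Real.sinh l - rootR X l) / (Real.cosh l + rootR X l) := by
    rw [pairF_of_upperRadius_le hl]
    have h2 : l - Real.log (Real.cosh l + rootR X l) =
        Real.log (Real.exp l / (Real.cosh l + rootR X l)) := by
      rw [Real.log_div (Real.exp_pos _).ne' hp.ne', Real.log_exp]
    rw [h2]
    refine (Real.log_le_sub_one_of_pos (by positivity)).trans_eq ?_
    rw [← Real.cosh_add_sinh]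
    field_simp
    ring
  have h3 : (Real.sinh l - rootR X l) * Real.sinh l ≤ X ^ 2 := by nlinarith
  calc pairF X l * Real.sinh l
      ≤ (Real.sinh l - rootR X l) / (Real.cosh l + rootR X l) * Real.sinh l := by gcongr
    _ = (Real.sinh l - rootR X l) * Real.sinh l / (Real.cosh l + rootR X l) := by ring
    _ ≤ X ^ 2 / (Real.cosh l + rootR X l) := by gcongr
    _ ≤ X ^ 2 / Real.cosh l := by
      gcongr
      linarith

/-- Qualitative: `D` depends on `X` in an uncontrolled way and serves only for convergence. -/
theorem exists_pairF_mul_sinh_le {X : ℝ} (hX : 0 < X) :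
    ∃ D : ℝ, 0 ≤ D ∧ ∀ l, 0 ≤ l → pairF X l * Real.sinh l ≤ D * Real.exp (-l) := by
  obtain ⟨C, hC⟩ := (isCompact_Icc (a := 0) (b := upperRadius X)).exists_bound_of_continuousOn
    (f := fun l => pairF X l * Real.sinh l * Real.exp l)
    (((continuous_pairF hX).mul Real.continuous_sinh).mul Real.continuous_exp).continuousOn
  refine ⟨max C (2 * X ^ 2), by positivity, fun l hl => ?_⟩
  rw [Real.exp_neg, ← div_eq_mul_inv, le_div_iff₀ (Real.exp_pos l)]
  rcases le_total l (upperRadius X) with h | h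
  · exact ((Real.le_norm_self _).trans (hC l ⟨hl, h⟩)).trans (le_max_left _ _)
  · refine le_trans ?_ (le_max_right _ _)
    have h1 := pairF_mul_sinh_le hX h
    have hc := Real.cosh_pos l
    have h2 : Real.exp l ≤ 2 * Real.cosh l := by
      rw [← Real.cosh_add_sinh]
      linarith [Real.sinh_lt_cosh l]
    calc pairF X l * Real.sinh l * Real.exp l ≤ X ^ 2 / Real.cosh l * (2 * Real.cosh l) := by
          gcongr
      _ = _ := by field_simp

/-- For `X ≥ 1`, a bound for `pairF` below `upperRadius X`. -/
theorem pairF_mul_cosh_half_le {X l : ℝ} (hX : 1 ≤ X) (hl : 0 ≤ l) (hl' : l ≤ upperRadius X) :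
    pairF X l * Real.cosh (l / 2) ≤ 6 * X := by
  have hX0 : 0 < X := by linarith
  have hch := Real.cosh_pos (l / 2)
  rcases le_total l (lowerRadius X) with h1 | h1
  · rw [pairF_of_le_lowerRadius hX0 h1]
    have h2 : Real.sinh l ≤ X := by rwa [← sinh_lowerRadius X, Real.sinh_le_sinh]
    have h3 : l / 2 ≤ Real.sinh (l / 2) := Real.self_le_sinh_iff.2 (by positivity)
    rw [sinh_half_eq] at h2
    nlinarith
  · rw [pairF_of_middle h1 hl']
    have he := Real.exp_pos (l / 2)
    have hel : Real.exp (l / 2) ^ 2 = Real.exp l := by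
      rw [← Real.exp_nat_mul]; congr 1; push_cast; ring
    have hc2 : Real.exp l / 2 ≤ Real.cosh l := by
      rw [← Real.cosh_add_sinh]
      linarith [Real.sinh_lt_cosh l]
    have h2 : Real.log (Real.exp l / 2) ≤ Real.log (Real.cosh l + rootR X l) :=
      Real.log_le_log (by positivity) (by linarith [rootR_nonneg X l])
    -- Dropping `R` and using `cosh l ≥ e^l / 2` bounds `f` by twice one logarithm, to which `log y
    -- ≤ y` then applies.
    have h3 : l + Real.log (1 + X ^ 2) - 2 * Real.log (Real.exp l / 2) =
        2 * Real.log (2 * Real.sqrt (1 + X ^ 2) / Real.exp (l / 2)) := by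
      have hs : 0 < Real.sqrt (1 + X ^ 2) := Real.sqrt_pos.2 (by positivity)
      rw [Real.log_div (Real.exp_pos _).ne' two_ne_zero, Real.log_exp,
        Real.log_div (by positivity) he.ne', Real.log_exp, Real.log_mul two_ne_zero hs.ne',
        Real.log_sqrt (by positivity)]
      ring
    have hs : Real.sqrt (1 + X ^ 2) ≤ 3 / 2 * X := by
      rw [Real.sqrt_le_iff]
      constructor <;> nlinarith
    have h4 : Real.log (2 * Real.sqrt (1 + X ^ 2) / Real.exp (l / 2)) ≤ 3 * X / Real.exp (l / 2) := by
      refine (Real.log_le_self (by positivity)).trans ?_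
      exact div_le_div_of_nonneg_right (by linarith) he.le
    have h5 : Real.cosh (l / 2) ≤ Real.exp (l / 2) := by
      rw [← Real.cosh_add_sinh]
      linarith [Real.sinh_nonneg_iff.2 (by positivity : 0 ≤ l / 2)]
    calc (l + Real.log (1 + X ^ 2) - 2 * Real.log (Real.cosh l + rootR X l)) * Real.cosh (l / 2)
        ≤ (2 * (3 * X / Real.exp (l / 2))) * Real.cosh (l / 2) := by
          gcongr
          linarith
      _ ≤ (2 * (3 * X / Real.exp (l / 2))) * Real.exp (l / 2) := by gcongr
      _ = 6 * X := by field_simp; ring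

/-! ### Reduction to a radial integral, and absolute convergence. -/

theorem selbergIntegrand_geodesicPoint (X : ℝ) (t : ℂ) {q : ℝ × ℝ} (hq : 0 ≤ q.1) :
    selbergIntegrand (kernelK X) t (geodesicPoint q) =
      pairF X q.1 * heightPow (1 / 2 + Complex.I * t) q.1 q.2 := by
  have hp := invHeight_pos q.1 q.2
  rw [selbergIntegrand, kernelK, one_add_two_mul_pairU_geodesicPoint, Real.arcosh_cosh hq,
    geodesicPoint_im, heightPow, Complex.cpow_def_of_ne_zero (by exact_mod_cast (inv_pos.2 hp).ne'),
    ← Complex.ofReal_log (inv_pos.2 hp).le, Real.log_inv]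
  congr 2
  push_cast
  ring

theorem volume_restrict_polarCoord_target :
    (volume : Measure (ℝ × ℝ)).restrict polarCoord.target =
      (volume.restrict (Set.Ioi 0)).prod (volume.restrict (Set.Ioo (-Real.pi) Real.pi)) :=
  (Measure.prod_restrict _ _).symm

theorem continuous_exp_neg_mul_log_invHeight (σ : ℝ) :
    Continuous fun q : ℝ × ℝ => Real.exp (-σ * Real.log (invHeight q.1 q.2)) :=
  Real.continuous_exp.comp (continuous_const.mul continuous_log_invHeight)

theorem integral_Ioo_eq_sphR (σ l : ℝ) :
    ∫ θ in Set.Ioo (-Real.pi) Real.pi, Real.exp (-σ * Real.log (invHeight l θ)) = sphR σ l := by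
  rw [sphR, intervalIntegral.integral_of_le (by linarith [Real.pi_pos]),
    integral_Ioc_eq_integral_Ioo]

theorem integrableOn_polar {g : ℝ → ℝ} {σ : ℝ} (hg : Continuous g) (hg0 : ∀ l, 0 < l → 0 ≤ g l)
    (h : IntegrableOn (fun l => g l * sphR σ l) (Set.Ioi 0)) :
    IntegrableOn (fun q : ℝ × ℝ => g q.1 * Real.exp (-σ * Real.log (invHeight q.1 q.2)))
      polarCoord.target := by
  have hc : Continuous fun q : ℝ × ℝ =>
      g q.1 * Real.exp (-σ * Real.log (invHeight q.1 q.2)) :=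
    (hg.comp continuous_fst).mul (continuous_exp_neg_mul_log_invHeight σ)
  rw [IntegrableOn, volume_restrict_polarCoord_target,
    integrable_prod_iff hc.aestronglyMeasurable]
  refine ⟨Filter.Eventually.of_forall fun l => ?_, ?_⟩
  · have : Continuous fun θ => g l * Real.exp (-σ * Real.log (invHeight l θ)) :=
      continuous_const.mul (continuous_exp_log_invHeight σ l)
    exact (this.integrableOn_Icc (a := -Real.pi) (b := Real.pi)).mono_set Set.Ioo_subset_Icc_self
  · refine h.congr ?_
    filter_upwards [ae_restrict_mem measurableSet_Ioi] with l hl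
    rw [← integral_Ioo_eq_sphR, ← integral_const_mul]
    refine integral_congr_ae (Filter.Eventually.of_forall fun θ => ?_)
    simp only
    rw [Real.norm_of_nonneg (mul_nonneg (hg0 l hl) (Real.exp_pos _).le)]

/-- Since `e^(-l) ≤ p ≤ e^l`, powers with exponent at most `3/4` in absolute value cost `e^(3l/4)`.
For larger `σ` a factor `p^(-1)` is split off first; its circle integral is exactly `2π`, so it
costs no growth in `l`. -/
theorem exp_neg_mul_log_invHeight_le {σ l θ : ℝ} (hσ : -(3 / 4) ≤ σ) (hσ' : σ ≤ 7 / 4)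
    (hl : 0 ≤ l) :
    Real.exp (-σ * Real.log (invHeight l θ)) ≤ Real.exp (3 / 4 * l) *
      (1 + Real.exp (-1 * Real.log (invHeight l θ))) := by
  have h1 : -l ≤ Real.log (invHeight l θ) := by
    rw [Real.le_log_iff_exp_le (invHeight_pos l θ)]
    simpa [abs_of_nonneg hl] using exp_neg_abs_le_invHeight l θ
  have h2 : Real.log (invHeight l θ) ≤ l := by
    rw [Real.log_le_iff_le_exp (invHeight_pos l θ)]
    simpa [abs_of_nonneg hl] using invHeight_le_exp_abs l θ
  generalize Real.log (invHeight l θ) = L at *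
  have key : ∀ a : ℝ, |a| ≤ 3 / 4 → -a * L ≤ 3 / 4 * l := by
    intro a ha
    refine (le_abs_self _).trans ?_
    rw [abs_mul, abs_neg]
    have := abs_le.2 ⟨h1, h2⟩
    gcongr
  rw [mul_add, ← Real.exp_add, mul_one]
  by_cases h : σ ≤ 3 / 4
  · have := Real.exp_le_exp.2 (key σ (abs_le.2 ⟨hσ, h⟩))
    exact this.trans (le_add_of_nonneg_right (Real.exp_pos _).le)
  · have := key (σ - 1) (abs_le.2 ⟨by linarith, by linarith⟩)
    refine (Real.exp_le_exp.2 ?_).trans (le_add_of_nonneg_left (Real.exp_pos _).le)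
    linarith

theorem sphR_le_exp {σ l : ℝ} (hσ : -(3 / 4) ≤ σ) (hσ' : σ ≤ 7 / 4) (hl : 0 ≤ l) :
    sphR σ l ≤ 4 * Real.pi * Real.exp (3 / 4 * l) := by
  have h0 := continuous_exp_log_invHeight 1 l
  have h1 : sphR σ l ≤ ∫ θ in (-Real.pi)..Real.pi, Real.exp (3 / 4 * l) *
      (1 + Real.exp (-1 * Real.log (invHeight l θ))) :=
    intervalIntegral.integral_mono (by linarith [Real.pi_pos])
      ((continuous_exp_log_invHeight σ l).intervalIntegrable _ _)
      ((continuous_const.mul (continuous_const.add h0)).intervalIntegrable _ _)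
      fun θ => exp_neg_mul_log_invHeight_le hσ hσ' hl
  refine h1.trans_eq ?_
  rw [intervalIntegral.integral_const_mul, intervalIntegral.integral_add
    (continuous_const.intervalIntegrable _ _) (h0.intervalIntegrable _ _)]
  have := sphR_one l
  rw [sphR] at this
  rw [this, intervalIntegral.integral_const]
  simp only [smul_eq_mul]
  ring

theorem integrableOn_pairF_mul_sphR {X σ : ℝ} (hX : 0 < X) (hσ : -(3 / 4) ≤ σ) (hσ' : σ ≤ 7 / 4) :
    IntegrableOn (fun l => pairF X l * Real.sinh l * sphR σ l) (Set.Ioi 0) := by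
  obtain ⟨D, hD, h⟩ := exists_pairF_mul_sinh_le hX
  have hi : IntegrableOn (fun l : ℝ => 4 * Real.pi * D * Real.exp (-(1 / 4) * l)) (Set.Ioi 0) :=
    (exp_neg_integrableOn_Ioi 0 (by norm_num : (0 : ℝ) < 1 / 4)).const_mul _
  refine Integrable.mono' hi
    (((continuous_pairF hX).mul Real.continuous_sinh).mul
      (continuous_sphR σ)).aestronglyMeasurable ?_
  filter_upwards [ae_restrict_mem measurableSet_Ioi] with l hl
  have hl0 : (0 : ℝ) < l := hl
  have h1 : 0 ≤ pairF X l * Real.sinh l :=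
    mul_nonneg (pairF_nonneg hX hl0.le) (Real.sinh_nonneg_iff.2 hl0.le)
  rw [Real.norm_of_nonneg (mul_nonneg h1 (sphR_pos _ _).le)]
  calc pairF X l * Real.sinh l * sphR σ l
      ≤ (D * Real.exp (-l)) * (4 * Real.pi * Real.exp (3 / 4 * l)) :=
        mul_le_mul (h l hl0.le) (sphR_le_exp hσ hσ' hl0.le) (sphR_pos _ _).le (by positivity)
    _ = 4 * Real.pi * D * (Real.exp (-l) * Real.exp (3 / 4 * l)) := by ring
    _ = _ := by
      rw [← Real.exp_add]
      congr 2
      ring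

theorem integrableOn_pairF_mul_heightPow {X : ℝ} {s : ℂ} (hX : 0 < X) (hσ : -(3 / 4) ≤ s.re)
    (hσ' : s.re ≤ 7 / 4) :
    IntegrableOn (fun q : ℝ × ℝ => ((pairF X q.1 * Real.sinh q.1 : ℝ) : ℂ) * heightPow s q.1 q.2)
      polarCoord.target := by
  have h := integrableOn_polar ((continuous_pairF hX).mul Real.continuous_sinh)
    (fun l hl => mul_nonneg (pairF_nonneg hX hl.le) (Real.sinh_nonneg_iff.2 hl.le))
    (integrableOn_pairF_mul_sphR hX hσ hσ')
  refine Integrable.mono h ?_ ?_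
  · exact ((Complex.continuous_ofReal.comp (((continuous_pairF hX).comp continuous_fst).mul
      (Real.continuous_sinh.comp continuous_fst))).mul
      (continuous_heightPow s)).aestronglyMeasurable
  · refine Filter.Eventually.of_forall fun q => ?_
    rw [norm_mul, norm_mul, norm_heightPow, Complex.norm_real, Real.norm_of_nonneg (Real.exp_pos _).le]
    exact le_rfl

theorem smul_selbergIntegrand_geodesicPoint (X : ℝ) (t : ℂ) {q : ℝ × ℝ}
    (hq : q ∈ polarCoord.target) :
    Real.sinh q.1 • selbergIntegrand (kernelK X) t (geodesicPoint q) =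
      ((pairF X q.1 * Real.sinh q.1 : ℝ) : ℂ) * heightPow (1 / 2 + Complex.I * t) q.1 q.2 := by
  have hq1 : (0 : ℝ) < q.1 := hq.1
  rw [selbergIntegrand_geodesicPoint X t hq1.le, Complex.real_smul, Complex.ofReal_mul]
  ring

theorem integrable_selbergIntegrand {X : ℝ} {t : ℂ} (hX : 0 < X) (ht : |t.im| ≤ 5 / 4) :
    Integrable (selbergIntegrand (kernelK X) t) := by
  rw [integrable_upperHalfPlane_polar_iff]
  have hre : (1 / 2 + Complex.I * t).re = 1 / 2 - t.im := by
    simp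
    ring
  obtain ⟨h1, h2⟩ := abs_le.1 ht
  exact (integrableOn_congr_fun (fun q hq => smul_selbergIntegrand_geodesicPoint X t hq)
    measurableSet_polarCoord_target).2
      (integrableOn_pairF_mul_heightPow hX (by rw [hre]; linarith) (by rw [hre]; linarith))

/-- The Selberg transform as a radial integral against the spherical function. -/
theorem selbergTransform_eq_radial {X : ℝ} {t : ℂ} (hX : 0 < X) (ht : |t.im| ≤ 5 / 4) :
    selbergTransform (kernelK X) t =
      ∫ l in Set.Ioi 0, ((pairF X l * Real.sinh l : ℝ) : ℂ) * sph (1 / 2 + Complex.I * t) l := by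
  have hre : (1 / 2 + Complex.I * t).re = 1 / 2 - t.im := by
    simp
    ring
  obtain ⟨h1, h2⟩ := abs_le.1 ht
  have hi := integrableOn_pairF_mul_heightPow (s := 1 / 2 + Complex.I * t) hX
    (by rw [hre]; linarith) (by rw [hre]; linarith)
  rw [selbergTransform, integral_upperHalfPlane_polar,
    setIntegral_congr_fun measurableSet_polarCoord_target
      (fun q hq => smul_selbergIntegrand_geodesicPoint X t hq)]
  rw [IntegrableOn, volume_restrict_polarCoord_target] at hi
  rw [volume_restrict_polarCoord_target, integral_prod _ hi]
  congr 1
  funext l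
  simp only
  rw [integral_const_mul, sph, intervalIntegral.integral_of_le (by linarith [Real.pi_pos]),
    integral_Ioc_eq_integral_Ioo]

theorem norm_selbergIntegrand (k : ℝ → ℝ) (t : ℂ) (z : UpperHalfPlane) :
    ‖selbergIntegrand k t z‖ =
      |k (pairU UpperHalfPlane.I z)| * Real.exp ((1 / 2 - t.im) * Real.log z.im) := by
  have hz := z.im_pos
  rw [selbergIntegrand, norm_mul, Complex.norm_real, Complex.norm_cpow_eq_rpow_re_of_pos hz,
    Real.rpow_def_of_pos hz]
  congr 2
  rw [mul_comm]
  congr 1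
  simp
  ring

/-! ### Holomorphy in the strip. -/

theorem hasDerivAt_selbergIntegrand (k : ℝ → ℝ) (t : ℂ) (z : UpperHalfPlane) :
    HasDerivAt (fun t => selbergIntegrand k t z)
      (selbergIntegrand k t z * (Complex.I * Real.log z.im)) t := by
  have hz : (z.im : ℂ) ≠ 0 := by exact_mod_cast z.im_pos.ne'
  have h : HasDerivAt (fun t : ℂ => (1 / 2 + Complex.I * t : ℂ)) (Complex.I * 1) t :=
    ((hasDerivAt_id t).const_mul Complex.I).const_add _
  refine ((h.const_cpow (c := (z.im : ℂ)) (Or.inl hz)).const_mul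
    (k (pairU UpperHalfPlane.I z) : ℂ)).congr_deriv ?_
  rw [selbergIntegrand, Complex.ofReal_log z.im_pos.le]
  ring

/-- The logarithm from differentiating `y^s` costs `1/8` in the exponent: `[-5/8, 13/8]` widens to
`[-3/4, 7/4]`, the full range of convergence. -/
theorem abs_mul_exp_le {a L : ℝ} (ha : |a - 1 / 2| ≤ 9 / 8) :
    |L| * Real.exp (a * L) ≤ 16 * (Real.exp (-(3 / 4) * L) + Real.exp (7 / 4 * L)) := by
  obtain ⟨h1, h2⟩ := abs_le.1 ha
  have hL : |L| ≤ 8 * Real.exp (|L| / 8) := by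
    have := Real.add_one_le_exp (|L| / 8)
    linarith
  have h3 : Real.exp (|L| / 8 + a * L) ≤ Real.exp (-(3 / 4) * L) + Real.exp (7 / 4 * L) := by
    rcases le_total 0 L with h | h
    · rw [abs_of_nonneg h]
      refine (Real.exp_le_exp.2 ?_).trans (le_add_of_nonneg_left (Real.exp_pos _).le)
      nlinarith
    · rw [abs_of_nonpos h]
      refine (Real.exp_le_exp.2 ?_).trans (le_add_of_nonneg_right (Real.exp_pos _).le)
      nlinarith
  calc |L| * Real.exp (a * L) ≤ 8 * Real.exp (|L| / 8) * Real.exp (a * L) := by gcongr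
    _ = 8 * Real.exp (|L| / 8 + a * L) := by rw [Real.exp_add]; ring
    _ ≤ _ := by
      have := Real.exp_pos (-(3 / 4) * L)
      have := Real.exp_pos (7 / 4 * L)
      linarith

theorem differentiableOn_selbergTransform {X : ℝ} (hX : 0 < X) :
    DifferentiableOn ℂ (selbergTransform (kernelK X)) {t : ℂ | |t.im| < 9 / 8} := by
  have hopen : IsOpen {t : ℂ | |t.im| < 9 / 8} :=
    isOpen_lt (Complex.continuous_im.abs) continuous_const
  intro t ht
  have hm : {t : ℂ | |t.im| < 9 / 8} ∈ nhds t := hopen.mem_nhds ht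
  have hle : ∀ x : ℂ, |x.im| < 9 / 8 → |x.im| ≤ 5 / 4 := fun x hx => by linarith
  -- The integrands at the two edges of the strip `|Im t| ≤ 5/4` dominate the derivative throughout
  -- `|Im t| < 9/8`.
  let t₁ : ℂ := Complex.I * (5 / 4 : ℝ)
  let t₂ : ℂ := Complex.I * (-(5 / 4) : ℝ)
  have e1 : t₁.im = 5 / 4 := by simp only [t₁]; rw [Complex.I_mul_im, Complex.ofReal_re]
  have e2 : t₂.im = -(5 / 4) := by simp only [t₂]; rw [Complex.I_mul_im, Complex.ofReal_re]
  have hb : Integrable (fun z => 16 * (‖selbergIntegrand (kernelK X) t₁ z‖ +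
      ‖selbergIntegrand (kernelK X) t₂ z‖)) :=
    ((integrable_selbergIntegrand hX (by rw [e1]; norm_num [abs_of_pos])).norm.add
      (integrable_selbergIntegrand hX (by rw [e2]; norm_num [abs_of_pos])).norm).const_mul 16
  have hlog : Measurable fun z : UpperHalfPlane => (Complex.I * Real.log z.im : ℂ) :=
    (Complex.measurable_ofReal.comp (Real.measurable_log.comp
      UpperHalfPlane.continuous_im.measurable)).const_mul _
  have := hasDerivAt_integral_of_dominated_loc_of_deriv_le (μ := (volume : Measure UpperHalfPlane))
    (F := fun t z => selbergIntegrand (kernelK X) t z)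
    (F' := fun t z => selbergIntegrand (kernelK X) t z * (Complex.I * Real.log z.im))
    (bound := fun z => 16 * (‖selbergIntegrand (kernelK X) t₁ z‖ +
      ‖selbergIntegrand (kernelK X) t₂ z‖)) hm
    (by
      filter_upwards [hm] with x hx
      exact (integrable_selbergIntegrand hX (hle x hx)).aestronglyMeasurable)
    (integrable_selbergIntegrand hX (hle t ht))
    ((integrable_selbergIntegrand hX (hle t ht)).aestronglyMeasurable.mul
      hlog.aestronglyMeasurable)
    (Filter.Eventually.of_forall fun z x hx => by
      rw [norm_mul, norm_mul, Complex.norm_I, one_mul, Complex.norm_real, norm_selbergIntegrand,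
        norm_selbergIntegrand, norm_selbergIntegrand, e1, e2]
      have h := abs_mul_exp_le (a := 1 / 2 - x.im) (L := Real.log z.im)
        (by simpa using (show |x.im| < 9 / 8 from hx).le)
      have h' := mul_le_mul_of_nonneg_left h
        (abs_nonneg (kernelK X (pairU UpperHalfPlane.I z)))
      have e3 : (1 / 2 - 5 / 4 : ℝ) = -(3 / 4) := by norm_num
      have e4 : (1 / 2 - -(5 / 4) : ℝ) = 7 / 4 := by norm_num
      rw [e3, e4, Real.norm_eq_abs]
      linarith)
    hb (Filter.Eventually.of_forall fun z x _ => hasDerivAt_selbergIntegrand (kernelK X) x z)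
  exact this.2.differentiableAt.differentiableWithinAt

theorem analyticOnNhd_selbergTransform {X : ℝ} (hX : 0 < X) :
    AnalyticOnNhd ℂ (selbergTransform (kernelK X)) {t : ℂ | |t.im| ≤ 1} := by
  have hopen : IsOpen {t : ℂ | |t.im| < 9 / 8} :=
    isOpen_lt (Complex.continuous_im.abs) continuous_const
  refine ((differentiableOn_selbergTransform hX).analyticOnNhd hopen).mono fun t ht => ?_
  have : |t.im| ≤ 1 := ht
  exact show |t.im| < 9 / 8 by linarith

/-! ### Total mass of the weight and bounds for real `s`. -/

theorem sub_eq_sub_of_hasDerivAt {g B g' : ℝ → ℝ} {a b : ℝ} (hab : a ≤ b)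
    (hg : ContinuousOn g (Set.Icc a b)) (hB : ContinuousOn B (Set.Icc a b))
    (hg' : ∀ x ∈ Set.Ioo a b, HasDerivAt g (g' x) x)
    (hB' : ∀ x ∈ Set.Ioo a b, HasDerivAt B (g' x) x) : g b - g a = B b - B a :=
  le_antisymm (sub_le_sub_of_hasDerivAt_le hab hg hB hg' hB' fun _ _ => le_rfl)
    (sub_le_sub_of_hasDerivAt_le hab hB hg hB' hg' fun _ _ => le_rfl)

/-- The hyperbolic volume weight `pairF X l * sinh l`. -/
def weight (X l : ℝ) : ℝ := pairF X l * Real.sinh l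

theorem continuous_weight {X : ℝ} (hX : 0 < X) : Continuous (weight X) :=
  (continuous_pairF hX).mul Real.continuous_sinh

theorem weight_nonneg {X l : ℝ} (hX : 0 < X) (hl : 0 ≤ l) : 0 ≤ weight X l :=
  mul_nonneg (pairF_nonneg hX hl) (Real.sinh_nonneg_iff.2 hl)

theorem hasDerivAt_integral_weight_mul {X : ℝ} (hX : 0 < X) {g : ℝ → ℝ} (hg : Continuous g)
    (l : ℝ) : HasDerivAt (fun L => ∫ x in (0)..L, weight X x * g x) (weight X l * g l) l :=
  (((continuous_weight hX).mul hg).integral_hasStrictDerivAt 0 l).hasDerivAt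

theorem tendsto_sinh_atTop : Tendsto Real.sinh atTop atTop :=
  tendsto_atTop_mono' _ ((eventually_ge_atTop 0).mono fun _ h => Real.self_le_sinh_iff.2 h)
    tendsto_id

theorem pairF_mul_cosh_le {X l : ℝ} (hX : 0 < X) (hl : upperRadius X ≤ l) :
    pairF X l * Real.cosh l ≤ X ^ 2 / Real.sinh l := by
  have hS := Real.sinh_pos_iff.2 ((upperRadius_pos hX).trans_le hl)
  have h := pairF_mul_sinh_le hX hl
  rw [le_div_iff₀ (Real.cosh_pos l)] at h
  rw [le_div_iff₀ hS]
  linarith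

theorem tendsto_pairF_mul_cosh {X : ℝ} (hX : 0 < X) :
    Tendsto (fun l => pairF X l * Real.cosh l) atTop (𝓝 0) := by
  have h : Tendsto (fun l => X ^ 2 / Real.sinh l) atTop (𝓝 0) :=
    tendsto_const_nhds.div_atTop tendsto_sinh_atTop
  refine tendsto_of_tendsto_of_tendsto_of_le_of_le' tendsto_const_nhds h ?_ ?_
  · filter_upwards [eventually_ge_atTop 0] with l hl
    exact mul_nonneg (pairF_nonneg hX hl) (Real.cosh_pos l).le
  · filter_upwards [eventually_ge_atTop (upperRadius X)] with l hl
    exact pairF_mul_cosh_le hX hl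

theorem tendsto_sinh_sub_rootR {X : ℝ} (hX : 0 < X) :
    Tendsto (fun l => Real.sinh l - rootR X l) atTop (𝓝 0) := by
  have h : Tendsto (fun l => X ^ 2 / Real.sinh l) atTop (𝓝 0) :=
    tendsto_const_nhds.div_atTop tendsto_sinh_atTop
  refine tendsto_of_tendsto_of_tendsto_of_le_of_le' tendsto_const_nhds h ?_ ?_
  · filter_upwards [eventually_ge_atTop 0] with l hl
    exact sub_nonneg.2 (rootR_le_sinh hl)
  · filter_upwards [eventually_ge_atTop (upperRadius X)] with l hl
    have hS := Real.sinh_pos_iff.2 ((upperRadius_pos hX).trans_le hl)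
    rw [le_div_iff₀ hS]
    have := rootR_sq hX ((lowerRadius_lt_upperRadius hX).le.trans hl)
    have := rootR_le_sinh (X := X) ((upperRadius_pos hX).le.trans hl)
    nlinarith [rootR_nonneg X l]

/-- On the three pieces `f' = 1 - k sinh / R` with `k = 0, 2, 1`, and `R' = sinh cosh / R`, so `f
cosh - sinh + k R` is an antiderivative of `f sinh`. The jump of `k` is harmless at `lowerRadius`,
where `R = 0`; at `upperRadius`, where `R = X²/2`, it produces the constant. -/
theorem integral_weight_eq {X L : ℝ} (hX : 0 < X) (hL : upperRadius X ≤ L) :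
    ∫ l in (0)..L, weight X l =
      pairF X L * Real.cosh L - (Real.sinh L - rootR X L) + X ^ 2 / 2 := by
  have h12 := lowerRadius_lt_upperRadius hX
  have hf := continuous_pairF hX
  have hR := continuous_rootR X
  have hA : ∀ l, HasDerivAt (fun L => ∫ x in (0)..L, weight X x) (weight X l) l := fun l =>
    ((continuous_weight hX).integral_hasStrictDerivAt 0 l).hasDerivAt
  have hAc : Continuous fun L => ∫ x in (0)..L, weight X x :=
    continuous_iff_continuousAt.2 fun l => (hA l).continuousAt
  have e1 := sub_eq_sub_of_hasDerivAt (B := fun l => pairF X l * Real.cosh l - Real.sinh l)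
    (lowerRadius_pos hX).le hAc.continuousOn (by fun_prop) (fun l _ => hA l) (fun l hl => by
      refine (((hasDerivAt_pairF_low hX hl.2).mul (Real.hasDerivAt_cosh l)).sub
        (Real.hasDerivAt_sinh l)).congr_deriv ?_
      rw [weight]
      ring)
  have e2 := sub_eq_sub_of_hasDerivAt
    (B := fun l => pairF X l * Real.cosh l - Real.sinh l + 2 * rootR X l)
    h12.le hAc.continuousOn (by fun_prop) (fun l _ => hA l) (fun l hl => by
      refine ((((hasDerivAt_pairF_middle hX hl.1 hl.2).mul (Real.hasDerivAt_cosh l)).sub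
        (Real.hasDerivAt_sinh l)).add ((hasDerivAt_rootR hX hl.1).const_mul 2)).congr_deriv ?_
      rw [weight]
      ring)
  have e3 := sub_eq_sub_of_hasDerivAt
    (B := fun l => pairF X l * Real.cosh l - Real.sinh l + rootR X l)
    hL hAc.continuousOn (by fun_prop) (fun l _ => hA l) (fun l hl => by
      refine ((((hasDerivAt_pairF_high hX hl.1).mul (Real.hasDerivAt_cosh l)).sub
        (Real.hasDerivAt_sinh l)).add (hasDerivAt_rootR hX (h12.trans hl.1))).congr_deriv ?_
      rw [weight]
      ring)
  simp only [intervalIntegral.integral_same, Real.sinh_zero,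
    pairF_of_le_lowerRadius hX (lowerRadius_pos hX).le, rootR_lowerRadius, rootR_upperRadius]
    at e1 e2 e3
  linarith

theorem integrableOn_weight_mul_sphR {X σ : ℝ} (hX : 0 < X) (hσ : -(3 / 4) ≤ σ) (hσ' : σ ≤ 7 / 4) :
    IntegrableOn (fun l => weight X l * sphR σ l) (Set.Ioi 0) :=
  integrableOn_pairF_mul_sphR hX hσ hσ'

theorem integrableOn_weight {X : ℝ} (hX : 0 < X) : IntegrableOn (weight X) (Set.Ioi 0) := by
  have h := (integrableOn_weight_mul_sphR (σ := 0) hX (by norm_num) (by norm_num)).mul_const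
    (2 * Real.pi)⁻¹
  refine h.congr (Eventually.of_forall fun l => ?_)
  have := Real.pi_pos
  simp only [sphR_zero]
  field_simp

/-- The total mass of the weight. -/
theorem integral_Ioi_weight {X : ℝ} (hX : 0 < X) : ∫ l in Set.Ioi 0, weight X l = X ^ 2 / 2 := by
  refine tendsto_nhds_unique
    (intervalIntegral_tendsto_integral_Ioi 0 (integrableOn_weight hX) tendsto_id) ?_
  have h := ((tendsto_pairF_mul_cosh hX).sub (tendsto_sinh_sub_rootR hX)).add_const (X ^ 2 / 2)
  rw [sub_zero, zero_add] at h
  refine h.congr' ?_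
  filter_upwards [eventually_ge_atTop (upperRadius X)] with L hL
  exact (integral_weight_eq hX hL).symm

/-- The radial integral of the weight against the spherical function of real parameter. -/
def realTransform (X σ : ℝ) : ℝ := ∫ l in Set.Ioi 0, weight X l * sphR σ l

theorem realTransform_zero {X : ℝ} (hX : 0 < X) : realTransform X 0 = Real.pi * X ^ 2 := by
  simp only [realTransform, sphR_zero]
  rw [integral_mul_const, integral_Ioi_weight hX]
  ring

theorem realTransform_one {X : ℝ} (hX : 0 < X) : realTransform X 1 = Real.pi * X ^ 2 := by
  simp only [realTransform, sphR_one]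
  rw [integral_mul_const, integral_Ioi_weight hX]
  ring

theorem realTransform_le_combination {X σ a b α β : ℝ} (hX : 0 < X)
    (hσ : -(3 / 4) ≤ σ) (hσ' : σ ≤ 7 / 4) (hα : -(3 / 4) ≤ α) (hα' : α ≤ 7 / 4)
    (hβ : -(3 / 4) ≤ β) (hβ' : β ≤ 7 / 4)
    (h : ∀ p : ℝ, 0 < p → Real.exp (-σ * Real.log p) ≤
      a * Real.exp (-α * Real.log p) + b * Real.exp (-β * Real.log p)) :
    realTransform X σ ≤ a * realTransform X α + b * realTransform X β := by
  have ha := (integrableOn_weight_mul_sphR hX hα hα').const_mul a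
  have hb := (integrableOn_weight_mul_sphR hX hβ hβ').const_mul b
  unfold realTransform
  rw [← integral_const_mul, ← integral_const_mul, ← integral_add ha hb]
  refine setIntegral_mono_on (integrableOn_weight_mul_sphR hX hσ hσ') (ha.add hb)
    measurableSet_Ioi fun l hl => ?_
  have h1 := mul_le_mul_of_nonneg_left (sphR_mono_combination (l := l) h)
    (weight_nonneg hX (Set.mem_Ioi.1 hl).le)
  linarith

theorem cosh_upperRadius_half_le {X : ℝ} (hX : 1 ≤ X) :
    Real.cosh (upperRadius X / 2) ≤ 2 * X := by
  have h := Real.cosh_sq (upperRadius X / 2)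
  rw [sinh_upperRadius_half] at h
  have := Real.cosh_pos (upperRadius X / 2)
  nlinarith

theorem le_cosh_half {X l : ℝ} (hl : upperRadius X ≤ l) : X / 2 ≤ Real.cosh (l / 2) := by
  have h := upperRadius_le_iff.1 hl
  linarith [Real.sinh_lt_cosh (l / 2)]

/-- Below `upperRadius`, `f cosh(l/2) ≤ 6X` and the decay of `sphR (1/2)` leave a multiple of `X
sinh(l/2) / √cosh(l/2)`, with antiderivative a multiple of `X √cosh(l/2)`. Above it, `sphR (1/2) ≪
X^(-1/2)` is paired with the total mass `X²/2`. -/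
theorem realTransform_half_le {X : ℝ} (hX : 1 ≤ X) :
    realTransform X (1 / 2) ≤ 1000 * X ^ (3 / 2 : ℝ) := by
  have hX0 : 0 < X := by linarith
  have hπ := Real.pi_pos
  have hu := upperRadius_pos hX0
  have hc1 := continuous_sphR (1 / 2)
  have hA := hasDerivAt_integral_weight_mul hX0 hc1
  have hW : ∀ l, HasDerivAt (fun L => ∫ x in (0)..L, weight X x) (weight X l) l := fun l =>
    ((continuous_weight hX0).integral_hasStrictDerivAt 0 l).hasDerivAt
  have hAc : Continuous fun L => ∫ x in (0)..L, weight X x * sphR (1 / 2) x :=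
    continuous_iff_continuousAt.2 fun l => (hA l).continuousAt
  have hWc : Continuous fun L => ∫ x in (0)..L, weight X x :=
    continuous_iff_continuousAt.2 fun l => (hW l).continuousAt
  have hq : ∀ l : ℝ, HasDerivAt (fun l : ℝ => Real.sqrt (Real.cosh (l / 2)))
      (Real.sinh (l / 2) * (1 / 2) / (2 * Real.sqrt (Real.cosh (l / 2)))) l := fun l =>
    (((hasDerivAt_id l).div_const 2).cosh).sqrt (Real.cosh_pos _).ne'
  have b1 := sub_le_sub_of_hasDerivAt_le
    (B := fun l => 96 * Real.pi * X * Real.sqrt (Real.cosh (l / 2))) hu.le hAc.continuousOn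
    (by fun_prop) (fun l _ => hA l) (fun l _ => (hq l).const_mul _) (fun l hl => by
      have h1 := pairF_mul_cosh_half_le hX hl.1.le hl.2.le
      have h2 := sphR_half_le_cosh hl.1.le
      have hs := Real.sinh_pos_iff.2 (half_pos hl.1)
      have hr : 0 < Real.sqrt (Real.cosh (l / 2)) := Real.sqrt_pos.2 (Real.cosh_pos _)
      calc weight X l * sphR (1 / 2) l
          ≤ weight X l * (2 * Real.pi / Real.sqrt (Real.cosh (l / 2))) :=
            mul_le_mul_of_nonneg_left h2 (weight_nonneg hX0 hl.1.le)
        _ = (pairF X l * Real.cosh (l / 2)) *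
            (4 * Real.pi * Real.sinh (l / 2) / Real.sqrt (Real.cosh (l / 2))) := by
            rw [weight, sinh_half_eq]
            ring
        _ ≤ (6 * X) * (4 * Real.pi * Real.sinh (l / 2) / Real.sqrt (Real.cosh (l / 2))) := by
            gcongr
        _ = _ := by
            field_simp
            norm_num)
  have hsX : Real.sqrt X * Real.sqrt X = X := Real.mul_self_sqrt hX0.le
  have hsX0 : 0 < Real.sqrt X := Real.sqrt_pos.2 hX0
  have b2 : ∀ L, upperRadius X ≤ L →
      (∫ x in (0)..L, weight X x * sphR (1 / 2) x) -
        (∫ x in (0)..(upperRadius X), weight X x * sphR (1 / 2) x) ≤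
      4 * Real.pi / Real.sqrt X * (X ^ 2 / 2) := by
    intro L hL
    have h := sub_le_sub_of_hasDerivAt_le
      (B := fun L => 4 * Real.pi / Real.sqrt X * ∫ x in (0)..L, weight X x) hL hAc.continuousOn
      (by fun_prop) (fun l _ => hA l) (fun l _ => (hW l).const_mul _) (fun l hl => by
        have h2 := sphR_half_le_cosh (hu.le.trans hl.1.le)
        have h3 : Real.sqrt X / 2 ≤ Real.sqrt (Real.cosh (l / 2)) := by
          refine Real.le_sqrt_of_sq_le ?_
          have := le_cosh_half hl.1.le
          nlinarith
        have h4 : sphR (1 / 2) l ≤ 4 * Real.pi / Real.sqrt X :=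
          calc sphR (1 / 2) l ≤ 2 * Real.pi / Real.sqrt (Real.cosh (l / 2)) := h2
            _ ≤ 2 * Real.pi / (Real.sqrt X / 2) := by gcongr
            _ = _ := by field_simp; norm_num
        have := mul_le_mul_of_nonneg_left h4 (weight_nonneg hX0 (hu.le.trans hl.1.le))
        linarith)
    refine h.trans ?_
    rw [← mul_sub]
    have h5 : ∫ x in (0)..L, weight X x ≤ X ^ 2 / 2 := by
      rw [← integral_Ioi_weight hX0, intervalIntegral.integral_of_le (hu.le.trans hL)]
      refine setIntegral_mono_set (integrableOn_weight hX0) ?_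
        (Eventually.of_forall fun x hx => hx.1)
      filter_upwards [ae_restrict_mem measurableSet_Ioi] with l hl
      exact weight_nonneg hX0 (Set.mem_Ioi.1 hl).le
    have h6 : 0 ≤ ∫ x in (0)..(upperRadius X), weight X x :=
      intervalIntegral.integral_nonneg hu.le fun x hx => weight_nonneg hX0 hx.1
    gcongr
    linarith
  have hXr : X ^ (3 / 2 : ℝ) = X * Real.sqrt X := by
    rw [Real.sqrt_eq_rpow, ← Real.rpow_one_add' hX0.le (by norm_num)]
    norm_num
  have hsc : Real.sqrt (Real.cosh (upperRadius X / 2)) ≤ 2 * Real.sqrt X := by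
    refine Real.sqrt_le_iff.2 ⟨by positivity, ?_⟩
    have := cosh_upperRadius_half_le hX
    nlinarith
  have e1 : 4 * Real.pi / Real.sqrt X * (X ^ 2 / 2) = 2 * Real.pi * (X * Real.sqrt X) := by
    rw [div_mul_eq_mul_div, div_eq_iff hsX0.ne']
    linear_combination (-2 * Real.pi * X) * hsX
  have e2 : 96 * Real.pi * X * Real.sqrt (Real.cosh (upperRadius X / 2)) ≤
      192 * Real.pi * (X * Real.sqrt X) := by
    calc _ ≤ 96 * Real.pi * X * (2 * Real.sqrt X) := by gcongr
      _ = _ := by ring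
  refine le_of_tendsto (intervalIntegral_tendsto_integral_Ioi 0
    (integrableOn_weight_mul_sphR hX0 (by norm_num) (by norm_num)) tendsto_id) ?_
  filter_upwards [eventually_ge_atTop (upperRadius X)] with L hL
  have h := b2 L hL
  simp only [intervalIntegral.integral_same, id] at b1 h ⊢
  have h0 : 0 ≤ 96 * Real.pi * X * Real.sqrt (Real.cosh (0 / 2)) := by positivity
  have hp : Real.pi ≤ 4 := Real.pi_le_four
  have hXs : 0 < X * Real.sqrt X := by positivity
  rw [hXr]
  nlinarith

theorem half_add_I_mul_re (t : ℂ) : (1 / 2 + Complex.I * t).re = 1 / 2 - t.im := by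
  simp
  ring

theorem norm_selbergTransform_le {X : ℝ} {t : ℂ} (hX : 0 < X) (ht : |t.im| ≤ 5 / 4) :
    ‖selbergTransform (kernelK X) t‖ ≤ realTransform X (1 / 2 - t.im) := by
  obtain ⟨h1, h2⟩ := abs_le.1 ht
  rw [selbergTransform_eq_radial hX ht]
  refine norm_integral_le_of_norm_le
    (integrableOn_weight_mul_sphR hX (by linarith) (by linarith)) ?_
  filter_upwards [ae_restrict_mem measurableSet_Ioi] with l hl
  have h0 := weight_nonneg hX (Set.mem_Ioi.1 hl).le
  rw [norm_mul, Complex.norm_real, ← weight, Real.norm_of_nonneg h0, ← half_add_I_mul_re]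
  exact mul_le_mul_of_nonneg_left (norm_sph_le _ _) h0

theorem selbergTransform_I_div_two {X : ℝ} (hX : 0 < X) :
    selbergTransform (kernelK X) (Complex.I / 2) = ((Real.pi * X ^ 2 : ℝ) : ℂ) := by
  have him : (Complex.I / 2).im = 1 / 2 := by simp
  have hs : 1 / 2 + Complex.I * (Complex.I / 2) = ((0 : ℝ) : ℂ) := by
    rw [← mul_div_assoc, Complex.I_mul_I]
    norm_num
  rw [selbergTransform_eq_radial hX (by rw [him]; norm_num [abs_of_pos]), hs,
    ← realTransform_zero hX, realTransform, ← integral_complex_ofReal]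
  congr 1
  funext l
  rw [sph_ofReal, ← Complex.ofReal_mul, weight]

theorem sq_le_rpow_of_le_one {X e : ℝ} (hX : 0 < X) (hX1 : X ≤ 1) (he : e ≤ 2) :
    X ^ 2 ≤ X ^ e := by
  rw [← Real.rpow_two]
  exact Real.rpow_le_rpow_of_exponent_ge hX hX1 he

/-- From `p^(-σ) ≤ 1 + p^(-1)` and the two endpoint values. -/
theorem realTransform_le_of_le_one {X σ : ℝ} (hX : 0 < X) (h0 : 0 ≤ σ) (h1 : σ ≤ 1) :
    realTransform X σ ≤ 2 * Real.pi * X ^ 2 := by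
  have h := realTransform_le_combination (σ := σ) (a := 1) (b := 1) (α := 0) (β := 1) hX
    (by linarith) (by linarith) (by norm_num) (by norm_num) (by norm_num) (by norm_num)
    (fun p _ => by
      have e1 := Real.exp_pos (-1 * Real.log p)
      rw [neg_zero, zero_mul, Real.exp_zero, mul_one, one_mul]
      rcases le_total 0 (Real.log p) with h | h
      · have : Real.exp (-σ * Real.log p) ≤ 1 := Real.exp_le_one_iff.2 (by nlinarith)
        linarith
      · have : Real.exp (-σ * Real.log p) ≤ Real.exp (-1 * Real.log p) :=
          Real.exp_le_exp.2 (by nlinarith)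
        linarith)
  rw [realTransform_zero hX, realTransform_one hX] at h
  linarith

/-- Interpolation between the parameter `1/2` and the parameter `β`. -/
theorem realTransform_interpolate {X β τ : ℝ} (hX : 1 ≤ X) (hβ0 : 0 ≤ β) (hβ1 : β ≤ 1)
    (hβ : realTransform X β ≤ 1000 * X ^ 2) (h0 : 0 ≤ τ) (h1 : τ ≤ 1) :
    realTransform X ((1 - τ) * (1 / 2) + τ * β) ≤ 1000 * X ^ ((3 + τ) / 2) := by
  have hX0 : 0 < X := by linarith
  have h := realTransform_le_combination (σ := (1 - τ) * (1 / 2) + τ * β)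
    (a := (1 - τ) * X ^ (τ / 2)) (b := τ * X ^ (-((1 - τ) / 2))) (α := 1 / 2) (β := β) hX0
    (by nlinarith) (by nlinarith) (by norm_num) (by norm_num) (by linarith) (by linarith)
    (fun p _ => by
      -- Weighted AM-GM for `p^(-1/2) X^(τ/2)` and `p^(-β) X^(-(1-τ)/2)`: the powers of `X` cancel
      -- in the geometric mean, and they bring `X^(3/2)` and `X²` to the common size `X^((3+τ)/2)`.
      have hconv := convexOn_exp.2 (Set.mem_univ (-(1 / 2) * Real.log p + τ / 2 * Real.log X))
        (Set.mem_univ (-β * Real.log p + -((1 - τ) / 2) * Real.log X))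
        (sub_nonneg.2 h1) h0 (by ring)
      rw [Real.exp_add (-(1 / 2) * Real.log p), Real.exp_add (-β * Real.log p)] at hconv
      simp only [smul_eq_mul] at hconv
      rw [Real.rpow_def_of_pos hX0, Real.rpow_def_of_pos hX0, mul_comm (Real.log X),
        mul_comm (Real.log X)]
      refine le_trans (le_of_eq ?_) (hconv.trans (le_of_eq ?_))
      · congr 1
        ring
      · ring)
  refine h.trans ?_
  have e1 : X ^ (τ / 2) * X ^ (3 / 2 : ℝ) = X ^ ((3 + τ) / 2) := by
    rw [← Real.rpow_add hX0]
    congr 1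
    ring
  have e2 : X ^ (-((1 - τ) / 2)) * X ^ 2 = X ^ ((3 + τ) / 2) := by
    rw [← Real.rpow_two, ← Real.rpow_add hX0]
    congr 1
    ring
  have hτ : 0 ≤ 1 - τ := by linarith
  calc (1 - τ) * X ^ (τ / 2) * realTransform X (1 / 2) +
        τ * X ^ (-((1 - τ) / 2)) * realTransform X β
      ≤ (1 - τ) * X ^ (τ / 2) * (1000 * X ^ (3 / 2 : ℝ)) +
        τ * X ^ (-((1 - τ) / 2)) * (1000 * X ^ 2) := by
        gcongr
        exact realTransform_half_le hX
    _ = (1 - τ) * 1000 * (X ^ (τ / 2) * X ^ (3 / 2 : ℝ)) +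
        τ * 1000 * (X ^ (-((1 - τ) / 2)) * X ^ 2) := by ring
    _ = 1000 * X ^ ((3 + τ) / 2) := by
        rw [e1, e2]
        ring

theorem realTransform_le {X s : ℝ} (hX : 0 < X) (h0 : 0 ≤ s) (h1 : s ≤ 1) :
    realTransform X s ≤ 1000 * X ^ max (2 - s) (1 + s) := by
  have hπ := Real.pi_le_four
  have hπ0 := Real.pi_pos
  rcases le_total X 1 with hX1 | hX1
  · have h2 := realTransform_le_of_le_one hX h0 h1
    have h3 := sq_le_rpow_of_le_one hX hX1 (e := max (2 - s) (1 + s))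
      (max_le (by linarith) (by linarith))
    have h4 : 0 < X ^ 2 := by positivity
    nlinarith
  · have hb : Real.pi * X ^ 2 ≤ 1000 * X ^ 2 := by
      gcongr
      linarith
    rcases le_total s (1 / 2) with hs | hs
    · have h2 := realTransform_interpolate (β := 0) (τ := 1 - 2 * s) hX1 le_rfl zero_le_one
        (by rw [realTransform_zero hX]; exact hb) (by linarith) (by linarith)
      have e1 : (1 - (1 - 2 * s)) * (1 / 2) + (1 - 2 * s) * 0 = s := by ring
      have e2 : (3 + (1 - 2 * s)) / 2 = 2 - s := by ring
      rw [e1, e2] at h2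
      refine h2.trans ?_
      gcongr
      exact le_max_left _ _
    · have h2 := realTransform_interpolate (β := 1) (τ := 2 * s - 1) hX1 zero_le_one le_rfl
        (by rw [realTransform_one hX]; exact hb) (by linarith) (by linarith)
      have e1 : (1 - (2 * s - 1)) * (1 / 2) + (2 * s - 1) * 1 = s := by ring
      have e2 : (3 + (2 * s - 1)) / 2 = 1 + s := by ring
      rw [e1, e2] at h2
      refine h2.trans ?_
      gcongr
      exact le_max_right _ _

theorem norm_selbergTransform_le_rpow {X s : ℝ} {t : ℂ} (hX : 0 < X) (h0 : 0 < s) (h1 : s < 1)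
    (hs : (s : ℂ) = 1 / 2 + Complex.I * t) :
    ‖selbergTransform (kernelK X) t‖ ≤ 1000 * X ^ max (2 - s) (1 + s) := by
  have h := congrArg Complex.re hs
  rw [half_add_I_mul_re, Complex.ofReal_re] at h
  have him : |t.im| ≤ 5 / 4 := abs_le.2 ⟨by linarith, by linarith⟩
  refine (norm_selbergTransform_le hX him).trans ?_
  rw [← h]
  exact realTransform_le hX h0.le h1.le

/-! ### Integration by parts against solutions of the radial equation. -/

section Parts

variable {X Λ : ℝ} {φ φ' : ℝ → ℂ}

/-- The remainder of the integration by parts in `Λ ∫ f φ sinh`, `f = pairF X`. -/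
def partsRemainder (X Λ : ℝ) (φ φ' : ℝ → ℂ) (l : ℝ) : ℂ :=
  Λ * (∫ x in (0)..l, (weight X x : ℂ) * φ x) + (pairF X l : ℂ) * ((Real.sinh l : ℂ) * φ' l)

theorem hasDerivAt_integral_weight_mul_complex (hX : 0 < X) (hφ : Continuous φ) (l : ℝ) :
    HasDerivAt (fun L => ∫ x in (0)..L, (weight X x : ℂ) * φ x) ((weight X l : ℂ) * φ l) l :=
  (((Complex.continuous_ofReal.comp (continuous_weight hX)).mul
    hφ).integral_hasStrictDerivAt 0 l).hasDerivAt

theorem continuous_partsRemainder (hX : 0 < X) (hφ : Continuous φ)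
    (hv : ∀ l, HasDerivAt (fun l => (Real.sinh l : ℂ) * φ' l) (-Λ * Real.sinh l * φ l) l) :
    Continuous (partsRemainder X Λ φ φ') := by
  have h1 : Continuous fun L => ∫ x in (0)..L, (weight X x : ℂ) * φ x :=
    continuous_iff_continuousAt.2 fun l =>
      (hasDerivAt_integral_weight_mul_complex hX hφ l).continuousAt
  have h2 : Continuous fun l => (Real.sinh l : ℂ) * φ' l :=
    continuous_iff_continuousAt.2 fun l => (hv l).continuousAt
  exact (continuous_const.mul h1).add
    ((Complex.continuous_ofReal.comp (continuous_pairF hX)).mul h2)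

/-- The two terms in `Λ` cancel by the eigenvalue equation, leaving `f' sinh φ'`. -/
theorem hasDerivAt_partsRemainder (hX : 0 < X) (hφ : Continuous φ)
    (hv : ∀ l, HasDerivAt (fun l => (Real.sinh l : ℂ) * φ' l) (-Λ * Real.sinh l * φ l) l)
    {l f' : ℝ} (hf : HasDerivAt (pairF X) f' l) :
    HasDerivAt (partsRemainder X Λ φ φ') (f' * ((Real.sinh l : ℂ) * φ' l)) l := by
  refine (((hasDerivAt_integral_weight_mul_complex hX hφ l).const_mul (Λ : ℂ)).add
    (hf.ofReal_comp.mul (hv l))).congr_deriv ?_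
  rw [weight, Complex.ofReal_mul]
  ring

/-- Integration by parts once more, on an interval on which the flux `f' sinh = W` is smooth. -/
theorem norm_partsRemainder_le (hX : 0 < X) (hφ : ∀ l, HasDerivAt φ (φ' l) l)
    (hv : ∀ l, HasDerivAt (fun l => (Real.sinh l : ℂ) * φ' l) (-Λ * Real.sinh l * φ l) l)
    {a b : ℝ} (hab : a ≤ b) {f' W W' B B' : ℝ → ℝ} (hWc : ContinuousOn W (Set.Icc a b))
    (hBc : ContinuousOn B (Set.Icc a b))
    (hf : ∀ x ∈ Set.Ioo a b, HasDerivAt (pairF X) (f' x) x)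
    (hWf : ∀ x ∈ Set.Ioo a b, W x = f' x * Real.sinh x)
    (hW : ∀ x ∈ Set.Ioo a b, HasDerivAt W (W' x) x)
    (hB : ∀ x ∈ Set.Ioo a b, HasDerivAt B (B' x) x)
    (h : ∀ x ∈ Set.Ioo a b, |W' x| * ‖φ x‖ ≤ B' x) :
    ‖partsRemainder X Λ φ φ' b‖ ≤ ‖partsRemainder X Λ φ φ' a‖ + |W a| * ‖φ a‖ +
      |W b| * ‖φ b‖ + (B b - B a) := by
  have hφc : Continuous φ := continuous_iff_continuousAt.2 fun l => (hφ l).continuousAt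
  have key := norm_sub_le_sub_of_hasDerivAt_le
    (g := fun l => partsRemainder X Λ φ φ' l - (W l : ℂ) * φ l)
    (g' := fun l => -(W' l : ℂ) * φ l) hab
    ((continuous_partsRemainder hX hφc hv).continuousOn.sub
      ((Complex.continuous_ofReal.comp_continuousOn hWc).mul hφc.continuousOn)) hBc
    (fun x hx => by
      refine ((hasDerivAt_partsRemainder hX hφc hv (hf x hx)).sub
        ((hW x hx).ofReal_comp.mul (hφ x))).congr_deriv ?_
      rw [hWf x hx, Complex.ofReal_mul]
      ring) hB
    (fun x hx => by
      rw [norm_mul, norm_neg, Complex.norm_real, Real.norm_eq_abs]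
      exact h x hx)
  have e : ∀ x, ‖(W x : ℂ) * φ x‖ = |W x| * ‖φ x‖ := fun x => by
    rw [norm_mul, Complex.norm_real, Real.norm_eq_abs]
  rw [← e, ← e]
  have e2 : partsRemainder X Λ φ φ' b = partsRemainder X Λ φ φ' a - (W a : ℂ) * φ a +
      (W b : ℂ) * φ b + ((partsRemainder X Λ φ φ' b - (W b : ℂ) * φ b) -
        (partsRemainder X Λ φ φ' a - (W a : ℂ) * φ a)) := by ring
  have n1 := norm_add_le (partsRemainder X Λ φ φ' a - (W a : ℂ) * φ a + (W b : ℂ) * φ b)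
    ((partsRemainder X Λ φ φ' b - (W b : ℂ) * φ b) -
        (partsRemainder X Λ φ φ' a - (W a : ℂ) * φ a))
  rw [← e2] at n1
  have n2 := norm_add_le (partsRemainder X Λ φ φ' a - (W a : ℂ) * φ a) ((W b : ℂ) * φ b)
  have n3 := norm_sub_le (partsRemainder X Λ φ φ' a) ((W a : ℂ) * φ a)
  linarith

theorem hasDerivAt_sinh_sq_div_rootR {l : ℝ} (hX : 0 < X) (hl : lowerRadius X < l) :
    HasDerivAt (fun l => Real.sinh l ^ 2 / rootR X l)
      (Real.sinh l * Real.cosh l / rootR X l -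
        X ^ 2 * (Real.sinh l * Real.cosh l / rootR X l) / rootR X l ^ 2) l := by
  have hR := rootR_pos hX hl
  have h2 := rootR_sq hX hl.le
  refine (((Real.hasDerivAt_sinh l).pow 2).div (hasDerivAt_rootR hX hl) hR.ne').congr_deriv ?_
  simp only [Pi.pow_apply]
  have h3 : X ^ 2 = Real.sinh l ^ 2 - rootR X l ^ 2 := by linarith
  rw [h3]
  field_simp
  norm_num
  ring

theorem hasDerivAt_sq_div_rootR {l : ℝ} (hX : 0 < X) (hl : lowerRadius X < l) :
    HasDerivAt (fun l => X ^ 2 / rootR X l)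
      (-(X ^ 2 * (Real.sinh l * Real.cosh l / rootR X l) / rootR X l ^ 2)) l := by
  have hR := rootR_pos hX hl
  refine ((hasDerivAt_const l (X ^ 2)).div (hasDerivAt_rootR hX hl) hR.ne').congr_deriv ?_
  ring

theorem continuousOn_div_rootR {a b : ℝ} (hX : 0 < X) (ha : lowerRadius X < a) {g : ℝ → ℝ}
    (hg : Continuous g) : ContinuousOn (fun l => g l / rootR X l) (Set.Icc a b) :=
  hg.continuousOn.div (continuous_rootR X).continuousOn fun _ hx =>
    (rootR_pos hX (ha.trans_le hx.1)).ne'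

variable {M K K' m r : ℝ}

/-- Here `f' = 1`, so the flux is `sinh`, rising from `0` to `X`: one `M X` is the boundary term and
one the variation. The trivial bound for `φ` is used, as the energy bound fails near `l = 0`. -/
theorem norm_partsRemainder_lowerRadius_le (hX : 0 < X) (hφ : ∀ l, HasDerivAt φ (φ' l) l)
    (hv : ∀ l, HasDerivAt (fun l => (Real.sinh l : ℂ) * φ' l) (-Λ * Real.sinh l * φ l) l)
    (hM : ∀ l, ‖φ l‖ ≤ M) :
    ‖partsRemainder X Λ φ φ' (lowerRadius X)‖ ≤ 2 * M * X := by
  have h := norm_partsRemainder_le hX hφ hv (lowerRadius_pos hX).le (f' := fun _ => 1)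
    (W := Real.sinh) (W' := Real.cosh) (B := fun l => M * Real.sinh l)
    (B' := fun l => M * Real.cosh l) (by fun_prop) (by fun_prop)
    (fun x hx => hasDerivAt_pairF_low hX hx.2) (fun _ _ => (one_mul _).symm)
    (fun x _ => Real.hasDerivAt_sinh x) (fun x _ => (Real.hasDerivAt_sinh x).const_mul _)
    (fun x _ => by
      rw [abs_of_pos (Real.cosh_pos x), mul_comm]
      exact mul_le_mul_of_nonneg_right (hM x) (Real.cosh_pos x).le)
  have h0 : partsRemainder X Λ φ φ' 0 = 0 := by
    simp [partsRemainder]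
  rw [h0, norm_zero, Real.sinh_zero, abs_zero, zero_mul, sinh_lowerRadius, abs_of_pos hX] at h
  have := mul_le_mul_of_nonneg_left (hM (lowerRadius X)) hX.le
  linarith

theorem sinh_sub_le_rootR {l : ℝ} (hX : 0 < X) (hl : lowerRadius X ≤ l) :
    Real.sinh l - X ≤ rootR X l := by
  have h := lowerRadius_le_iff.1 hl
  refine Real.le_sqrt_of_sq_le ?_
  nlinarith

/-- The contribution of a short interval near the square root singularity. -/
theorem norm_partsRemainder_near_le (hX : 0 < X) (hφ : ∀ l, HasDerivAt φ (φ' l) l)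
    (hv : ∀ l, HasDerivAt (fun l => (Real.sinh l : ℂ) * φ' l) (-Λ * Real.sinh l * φ l) l)
    (hm : lowerRadius X ≤ m) (hm' : m ≤ upperRadius X) (hK' : ∀ l, lowerRadius X ≤ l → ‖φ' l‖ ≤ K') :
    ‖partsRemainder X Λ φ φ' m‖ ≤ ‖partsRemainder X Λ φ φ' (lowerRadius X)‖ +
      3 * K' * Real.sinh m * rootR X m := by
  have hφc : Continuous φ := continuous_iff_continuousAt.2 fun l => (hφ l).continuousAt
  have hK0 : 0 ≤ K' := (norm_nonneg _).trans (hK' _ le_rfl)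
  have hRc := continuous_rootR X
  -- No second integration by parts here: `f'` is singular but integrable. Enlarging `1 + 2 sinh/R`
  -- to `cosh + 2 sinh cosh/R` makes the majorant the exact derivative of `sinh + 2R`.
  have h := norm_sub_le_sub_of_hasDerivAt_le (g := partsRemainder X Λ φ φ')
    (B := fun l => K' * Real.sinh m * (Real.sinh l + 2 * rootR X l)) hm
    (continuous_partsRemainder hX hφc hv).continuousOn (by fun_prop)
    (fun x hx => hasDerivAt_partsRemainder hX hφc hv
      (hasDerivAt_pairF_middle hX hx.1 (hx.2.trans_le hm')))
    (fun x hx => ((Real.hasDerivAt_sinh x).add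
      ((hasDerivAt_rootR hX hx.1).const_mul 2)).const_mul _)
    (fun x hx => by
      have hR := rootR_pos hX hx.1
      have hS := Real.sinh_pos_iff.2 ((lowerRadius_pos hX).trans hx.1)
      have hSm := Real.sinh_le_sinh.2 hx.2.le
      have hc := Real.one_le_cosh x
      have h3 : 0 < Real.sinh m := hS.trans_le hSm
      rw [norm_mul, norm_mul, Complex.norm_real, Complex.norm_real, Real.norm_eq_abs,
        Real.norm_of_nonneg hS.le]
      have h1 : |1 - 2 * (Real.sinh x / rootR X x)| ≤ 1 + 2 * (Real.sinh x / rootR X x) := by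
        have : 0 < Real.sinh x / rootR X x := by positivity
        rw [abs_le]
        constructor <;> linarith
      calc |1 - 2 * (Real.sinh x / rootR X x)| * (Real.sinh x * ‖φ' x‖)
          ≤ (1 + 2 * (Real.sinh x / rootR X x)) * (Real.sinh m * K') := by
            gcongr
            exact hK' x hx.1.le
        _ ≤ (Real.cosh x + 2 * (Real.sinh x * Real.cosh x / rootR X x)) * (Real.sinh m * K') := by
            have h2 : Real.sinh x ≤ Real.sinh x * Real.cosh x := le_mul_of_one_le_right hS.le hc
            gcongr
        _ = _ := by ring)
  have h1 := norm_sub_norm_le (partsRemainder X Λ φ φ' m)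
    (partsRemainder X Λ φ φ' (lowerRadius X))
  simp only [sinh_lowerRadius, rootR_lowerRadius] at h
  have h2 : 0 ≤ K' * Real.sinh m :=
    mul_nonneg hK0 (Real.sinh_nonneg_iff.2 ((lowerRadius_pos hX).le.trans hm))
  have h3 := mul_le_mul_of_nonneg_left (sinh_sub_le_rootR hX hm) h2
  linarith

/-- Since `sinh²/R = R + X²/R`, the flux is `sinh - 2R - 2X²/R`, a combination of monotone
functions. Giving every term the increasing sign yields the bound `sinh + 2R - 2X²/R` for its
variation. -/
theorem norm_partsRemainder_upperRadius_le (hX : 0 < X) (hφ : ∀ l, HasDerivAt φ (φ' l) l)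
    (hv : ∀ l, HasDerivAt (fun l => (Real.sinh l : ℂ) * φ' l) (-Λ * Real.sinh l * φ l) l)
    (hm : lowerRadius X < m) (hm' : m ≤ upperRadius X) (hK : ∀ l, lowerRadius X ≤ l → ‖φ l‖ ≤ K) :
    ‖partsRemainder X Λ φ φ' (upperRadius X)‖ ≤ ‖partsRemainder X Λ φ φ' m‖ +
      K * (Real.sinh m + 2 * (Real.sinh m ^ 2 / rootR X m) + 2 * (X ^ 2 / rootR X m) +
        (2 * Real.sinh (upperRadius X) + 2 * X ^ 2 + 4)) := by
  have hK0 : 0 ≤ K := (norm_nonneg _).trans (hK _ le_rfl)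
  have h12 := lowerRadius_lt_upperRadius hX
  have h := norm_partsRemainder_le hX hφ hv hm'
    (f' := fun x => 1 - 2 * (Real.sinh x / rootR X x))
    (W := fun l => Real.sinh l - 2 * (Real.sinh l ^ 2 / rootR X l))
    (B := fun l => K * (Real.sinh l + 2 * rootR X l - 2 * (X ^ 2 / rootR X l)))
    (Real.continuous_sinh.continuousOn.sub
      (continuousOn_const.mul (continuousOn_div_rootR hX hm (by fun_prop))))
    (continuousOn_const.mul ((Real.continuous_sinh.continuousOn.add
      (continuousOn_const.mul (continuous_rootR X).continuousOn)).sub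
      (continuousOn_const.mul (continuousOn_div_rootR hX hm continuous_const))))
    (fun x hx => hasDerivAt_pairF_middle hX (hm.trans hx.1) hx.2)
    (fun x _ => by ring)
    (fun x hx => (Real.hasDerivAt_sinh x).sub
      ((hasDerivAt_sinh_sq_div_rootR hX (hm.trans hx.1)).const_mul 2))
    (fun x hx => (((Real.hasDerivAt_sinh x).add
      ((hasDerivAt_rootR hX (hm.trans hx.1)).const_mul 2)).sub
      ((hasDerivAt_sq_div_rootR hX (hm.trans hx.1)).const_mul 2)).const_mul K)
    (fun x hx => by
      have hR := rootR_pos hX (hm.trans hx.1)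
      have hS := Real.sinh_pos_iff.2 ((lowerRadius_pos hX).trans (hm.trans hx.1))
      have hc := Real.cosh_pos x
      have h1 : 0 < Real.sinh x * Real.cosh x / rootR X x := by positivity
      have h2 : 0 < X ^ 2 * (Real.sinh x * Real.cosh x / rootR X x) / rootR X x ^ 2 := by positivity
      rw [mul_comm]
      refine mul_le_mul (hK x (hm.le.trans hx.1.le)) ?_ (abs_nonneg _) hK0
      rw [abs_le]
      constructor <;> linarith)
  have hRm := rootR_pos hX hm
  have hSm := Real.sinh_pos_iff.2 ((lowerRadius_pos hX).trans hm)
  have hSu := Real.sinh_pos_iff.2 (upperRadius_pos hX)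
  have hRu := rootR_mono (X := X) ((lowerRadius_pos hX).trans hm).le hm'
  have h1 : |Real.sinh m - 2 * (Real.sinh m ^ 2 / rootR X m)| ≤
      Real.sinh m + 2 * (Real.sinh m ^ 2 / rootR X m) := by
    have : 0 < Real.sinh m ^ 2 / rootR X m := by positivity
    rw [abs_le]
    constructor <;> linarith
  have e2 : Real.sinh (upperRadius X) ^ 2 / rootR X (upperRadius X) = 2 + X ^ 2 / 2 := by
    rw [rootR_upperRadius, sinh_sq_upperRadius]
    field_simp
  have e3 : X ^ 2 / (X ^ 2 / 2) = 2 := by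
    field_simp
  have h2 : |Real.sinh (upperRadius X) -
      2 * (Real.sinh (upperRadius X) ^ 2 / rootR X (upperRadius X))| ≤
      Real.sinh (upperRadius X) + (4 + X ^ 2) := by
    rw [e2, abs_le]
    have : 0 ≤ X ^ 2 := by positivity
    constructor <;> linarith
  simp only [rootR_upperRadius, e3] at h
  have h3 := mul_le_mul h1 (hK m hm.le) (norm_nonneg _) (by positivity)
  have h4 := mul_le_mul h2 (hK (upperRadius X) h12.le) (norm_nonneg _) (by positivity)
  rw [rootR_upperRadius] at h4
  have h5 : 0 ≤ K * Real.sinh m := by positivity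
  have h6 : 0 ≤ K * rootR X m := by positivity
  linarith

/-- The flux is `sinh - R - X²/R`, and `R' ≥ cosh`, so its variation is controlled by the increasing
function `R - sinh - X²/R`. This stays bounded at infinity, so the estimate is uniform in `m` and
survives the limit. -/
theorem norm_partsRemainder_far_le (hX : 0 < X) (hφ : ∀ l, HasDerivAt φ (φ' l) l)
    (hv : ∀ l, HasDerivAt (fun l => (Real.sinh l : ℂ) * φ' l) (-Λ * Real.sinh l * φ l) l)
    (hm : upperRadius X ≤ m) (hK : ∀ l, lowerRadius X ≤ l → ‖φ l‖ ≤ K) :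
    ‖partsRemainder X Λ φ φ' m‖ ≤ ‖partsRemainder X Λ φ φ' (upperRadius X)‖ +
      K * (2 * Real.sinh (upperRadius X) + X ^ 2 + 6) := by
  have hK0 : 0 ≤ K := (norm_nonneg _).trans (hK _ le_rfl)
  have h12 := lowerRadius_lt_upperRadius hX
  have h := norm_partsRemainder_le hX hφ hv hm
    (f' := fun x => 1 - Real.sinh x / rootR X x)
    (W := fun l => Real.sinh l - Real.sinh l ^ 2 / rootR X l)
    (B := fun l => K * (rootR X l - Real.sinh l - X ^ 2 / rootR X l))
    (Real.continuous_sinh.continuousOn.sub (continuousOn_div_rootR hX h12 (by fun_prop)))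
    (continuousOn_const.mul (((continuous_rootR X).continuousOn.sub
      Real.continuous_sinh.continuousOn).sub (continuousOn_div_rootR hX h12 continuous_const)))
    (fun x hx => hasDerivAt_pairF_high hX hx.1)
    (fun x _ => by ring)
    (fun x hx => (Real.hasDerivAt_sinh x).sub (hasDerivAt_sinh_sq_div_rootR hX (h12.trans hx.1)))
    (fun x hx => (((hasDerivAt_rootR hX (h12.trans hx.1)).sub (Real.hasDerivAt_sinh x)).sub
      (hasDerivAt_sq_div_rootR hX (h12.trans hx.1))).const_mul K)
    (fun x hx => by
      have hx0 := (upperRadius_pos hX).trans hx.1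
      have hR := rootR_pos hX (h12.trans hx.1)
      have hS := Real.sinh_pos_iff.2 hx0
      have hRS := rootR_le_sinh (X := X) hx0.le
      have hc := Real.cosh_pos x
      have h1 : Real.cosh x ≤ Real.sinh x * Real.cosh x / rootR X x := by
        rw [le_div_iff₀ hR]
        nlinarith
      have h2 : 0 < X ^ 2 * (Real.sinh x * Real.cosh x / rootR X x) / rootR X x ^ 2 := by positivity
      rw [mul_comm]
      refine mul_le_mul (hK x (h12.le.trans hx.1.le)) ?_ (abs_nonneg _) hK0
      rw [abs_le]
      constructor <;> linarith)
  have hm0 := (upperRadius_pos hX).trans_le hm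
  have hRm := rootR_pos hX (h12.trans_le hm)
  have hSm := Real.sinh_pos_iff.2 hm0
  have hSu := Real.sinh_pos_iff.2 (upperRadius_pos hX)
  have hRu := rootR_mono (X := X) (upperRadius_pos hX).le hm
  have hRSm := rootR_le_sinh (X := X) hm0.le
  have hRm2 := rootR_sq hX (h12.le.trans hm)
  have hRu2 := rootR_upperRadius X
  have e2 : Real.sinh (upperRadius X) ^ 2 / rootR X (upperRadius X) = 2 + X ^ 2 / 2 := by
    rw [rootR_upperRadius, sinh_sq_upperRadius]
    field_simp
  have e3 : X ^ 2 / (X ^ 2 / 2) = 2 := by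
    field_simp
  have h1 : |Real.sinh m - Real.sinh m ^ 2 / rootR X m| ≤ 2 := by
    have h3 : Real.sinh m ≤ Real.sinh m ^ 2 / rootR X m := by
      rw [le_div_iff₀ hRm]
      nlinarith
    have h4 : Real.sinh m ^ 2 / rootR X m ≤ Real.sinh m + 2 := by
      rw [div_le_iff₀ hRm]
      nlinarith
    rw [abs_le]
    constructor <;> linarith
  have h2 : |Real.sinh (upperRadius X) -
      Real.sinh (upperRadius X) ^ 2 / rootR X (upperRadius X)| ≤
      Real.sinh (upperRadius X) + (2 + X ^ 2 / 2) := by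
    rw [e2, abs_le]
    have : 0 ≤ X ^ 2 := by positivity
    constructor <;> linarith
  simp only [rootR_upperRadius, e3] at h
  have h3 := mul_le_mul h1 (hK m (h12.le.trans hm)) (norm_nonneg _) (by positivity)
  have h4 := mul_le_mul h2 (hK (upperRadius X) h12.le) (norm_nonneg _) (by positivity)
  rw [rootR_upperRadius] at h4
  have h5 : K * (rootR X m - Real.sinh m) ≤ 0 :=
    mul_nonpos_of_nonneg_of_nonpos hK0 (by linarith)
  have h6 : 0 ≤ K * (X ^ 2 / rootR X m) := by positivity
  have h7 : 0 ≤ K * X ^ 2 := by positivity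
  linarith

theorem tendsto_partsRemainder (hX : 0 < X) (hΛ : 0 ≤ Λ)
    (hv : ∀ l, HasDerivAt (fun l => (Real.sinh l : ℂ) * φ' l) (-Λ * Real.sinh l * φ l) l)
    (hM : ∀ l, ‖φ l‖ ≤ M)
    (hi : IntegrableOn (fun l => (weight X l : ℂ) * φ l) (Set.Ioi 0)) :
    Tendsto (partsRemainder X Λ φ φ') atTop
      (𝓝 (Λ * ∫ l in Set.Ioi 0, (weight X l : ℂ) * φ l)) := by
  have hM0 : 0 ≤ M := (norm_nonneg _).trans (hM 0)
  -- The boundary term at infinity vanishes because `sinh · φ' = O(cosh)` and `f cosh → 0`.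
  have hbound : ∀ l, 0 ≤ l → ‖(Real.sinh l : ℂ) * φ' l‖ ≤ Λ * M * Real.cosh l := by
    intro l hl
    have h := norm_sub_le_sub_of_hasDerivAt_le (g := fun l => (Real.sinh l : ℂ) * φ' l)
      (B := fun l => Λ * M * Real.cosh l) hl
      (fun x _ => (hv x).continuousAt.continuousWithinAt) (by fun_prop) (fun x _ => hv x)
      (fun x _ => (Real.hasDerivAt_cosh x).const_mul _) (fun x hx => by
        have hS := Real.sinh_pos_iff.2 hx.1
        rw [norm_mul, norm_mul, norm_neg, Complex.norm_real, Complex.norm_real,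
          Real.norm_of_nonneg hΛ, Real.norm_of_nonneg hS.le]
        calc Λ * Real.sinh x * ‖φ x‖ ≤ Λ * Real.sinh x * M := by
              gcongr
              exact hM x
          _ = _ := by ring)
    simp only [Real.sinh_zero, Complex.ofReal_zero, zero_mul, sub_zero, Real.cosh_zero] at h
    have := mul_nonneg hΛ hM0
    linarith
  have h1 : Tendsto (fun l => (pairF X l : ℂ) * ((Real.sinh l : ℂ) * φ' l)) atTop (𝓝 0) := by
    have h2 := (tendsto_pairF_mul_cosh hX).const_mul (Λ * M)
    rw [mul_zero] at h2
    refine squeeze_zero_norm' ?_ h2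
    filter_upwards [eventually_ge_atTop 0] with l hl
    rw [norm_mul, Complex.norm_real, Real.norm_of_nonneg (pairF_nonneg hX hl)]
    calc pairF X l * ‖(Real.sinh l : ℂ) * φ' l‖ ≤ pairF X l * (Λ * M * Real.cosh l) :=
          mul_le_mul_of_nonneg_left (hbound l hl) (pairF_nonneg hX hl)
      _ = _ := by ring
  have h3 := ((intervalIntegral_tendsto_integral_Ioi 0 hi tendsto_id).const_mul (Λ : ℂ)).add h1
  rw [add_zero] at h3
  exact h3

end Parts

/-! ### Decay in `t` on the real line. -/

theorem norm_sph_half_le (t l : ℝ) : ‖sph (1 / 2 + Complex.I * t) l‖ ≤ 2 * Real.pi := by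
  refine (norm_sph_le _ _).trans ?_
  rw [half_add_I_mul_re, Complex.ofReal_im, sub_zero]
  exact sphR_half_le l

theorem hasDerivAt_sinh_mul_sphDeriv_half (t l : ℝ) :
    HasDerivAt (fun l => (Real.sinh l : ℂ) * sphDeriv (1 / 2 + Complex.I * t) l)
      (-((1 / 4 + |t| ^ 2 : ℝ) : ℂ) * Real.sinh l * sph (1 / 2 + Complex.I * t) l) l := by
  refine (hasDerivAt_sinh_mul_sphDeriv _ l).congr_deriv ?_
  have e : ((1 / 4 + |t| ^ 2 : ℝ) : ℂ) = 1 / 4 + (t : ℂ) ^ 2 := by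
    rw [sq_abs]
    push_cast
    ring
  rw [e]
  linear_combination ((t : ℂ) ^ 2 * Real.sinh l * sph (1 / 2 + Complex.I * t) l) * Complex.I_sq

theorem norm_le_of_re_im_sq_le {z : ℂ} {a b : ℝ} (hb : 0 ≤ b) (hre : z.re ^ 2 ≤ a)
    (him : z.im ^ 2 ≤ a) (h : 2 * a ≤ b ^ 2) : ‖z‖ ≤ b := by
  refine abs_le_of_sq_le_sq' ?_ hb |>.2
  rw [← Complex.normSq_eq_norm_sq, Complex.normSq_apply]
  nlinarith

/-- The energy estimate applied to real and imaginary parts, which solve the same real equation. The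
square roots `r` of `|t|` and `x` of a lower bound for `sinh l` avoid fractional powers. -/
theorem sph_half_bounds {t l : ℝ} (ht : 1 ≤ |t|) (hl : 1 / |t| ≤ l) {x r : ℝ} (hx : 0 < x)
    (hr : 0 < r) (hr2 : r ^ 2 = |t|) (hxl : x ^ 2 ≤ Real.sinh l) :
    ‖sph (1 / 2 + Complex.I * t) l‖ ≤ 8 * Real.pi / (r * x) ∧
      ‖sphDeriv (1 / 2 + Complex.I * t) l‖ ≤ 18 * Real.pi * r / x := by
  have hπ := Real.pi_pos
  have hsph := fun l => hasDerivAt_sph (1 / 2 + Complex.I * t) l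
  have hflux := fun l => hasDerivAt_sinh_mul_sphDeriv_half t l
  have hre := radial_solution_bounds (u := fun l => (sph (1 / 2 + Complex.I * t) l).re)
    (u' := fun l => (sphDeriv (1 / 2 + Complex.I * t) l).re) (M := 2 * Real.pi) ht
    (fun l => Complex.reCLM.hasFDerivAt.comp_hasDerivAt l (hsph l))
    (fun l => by
      have h := Complex.reCLM.hasFDerivAt.comp_hasDerivAt l (hflux l)
      have e : ∀ z : ℂ, Complex.reCLM (-((1 / 4 + |t| ^ 2 : ℝ) : ℂ) * Real.sinh l * z) =
          -(1 / 4 + |t| ^ 2) * Real.sinh l * z.re := fun z => by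
        rw [← Complex.ofReal_neg, ← Complex.ofReal_mul, Complex.reCLM_apply, Complex.re_ofReal_mul]
      rw [e] at h
      refine h.congr_of_eventuallyEq (Eventually.of_forall fun x => ?_)
      simp only [Function.comp, Complex.reCLM_apply, Complex.re_ofReal_mul])
    (fun l => (Complex.abs_re_le_norm _).trans (norm_sph_half_le t l)) hl
  have him := radial_solution_bounds (u := fun l => (sph (1 / 2 + Complex.I * t) l).im)
    (u' := fun l => (sphDeriv (1 / 2 + Complex.I * t) l).im) (M := 2 * Real.pi) ht
    (fun l => Complex.imCLM.hasFDerivAt.comp_hasDerivAt l (hsph l))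
    (fun l => by
      have h := Complex.imCLM.hasFDerivAt.comp_hasDerivAt l (hflux l)
      have e : ∀ z : ℂ, Complex.imCLM (-((1 / 4 + |t| ^ 2 : ℝ) : ℂ) * Real.sinh l * z) =
          -(1 / 4 + |t| ^ 2) * Real.sinh l * z.im := fun z => by
        rw [← Complex.ofReal_neg, ← Complex.ofReal_mul, Complex.imCLM_apply, Complex.im_ofReal_mul]
      rw [e] at h
      refine h.congr_of_eventuallyEq (Eventually.of_forall fun x => ?_)
      simp only [Function.comp, Complex.imCLM_apply, Complex.im_ofReal_mul])
    (fun l => (Complex.abs_im_le_norm _).trans (norm_sph_half_le t l)) hl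
  have hx2 : 0 < x ^ 2 := by positivity
  have k1 : ∀ a : ℝ, |t| * Real.sinh l * a ^ 2 ≤ 8 * (2 * Real.pi) ^ 2 →
      a ^ 2 ≤ 8 * (2 * Real.pi) ^ 2 / (r ^ 2 * x ^ 2) := fun a ha => by
    rw [le_div_iff₀ (by positivity), hr2]
    refine le_trans ?_ ha
    have : 0 ≤ |t| := by linarith
    calc a ^ 2 * (|t| * x ^ 2) ≤ a ^ 2 * (|t| * Real.sinh l) := by gcongr
      _ = _ := by ring
  have k2 : ∀ a : ℝ, Real.sinh l * a ^ 2 ≤ 36 * (2 * Real.pi) ^ 2 * |t| →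
      a ^ 2 ≤ 36 * (2 * Real.pi) ^ 2 * r ^ 2 / x ^ 2 := fun a ha => by
    rw [le_div_iff₀ (by positivity), hr2]
    refine le_trans ?_ ha
    calc a ^ 2 * x ^ 2 ≤ a ^ 2 * Real.sinh l := by gcongr
      _ = _ := by ring
  constructor
  · refine norm_le_of_re_im_sq_le (by positivity) (k1 _ hre.1) (k1 _ him.1) (le_of_eq ?_)
    field_simp
    norm_num
  · refine norm_le_of_re_im_sq_le (by positivity) (k2 _ hre.2) (k2 _ him.2) ?_
    rw [div_pow, ← mul_div_assoc]
    gcongr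
    have : 0 ≤ Real.pi ^ 2 * r ^ 2 := by positivity
    nlinarith

theorem sinh_upperRadius_le {X : ℝ} (hX : 0 < X) :
    Real.sinh (upperRadius X) ≤ X + X ^ 2 / 2 := by
  refine abs_le_of_sq_le_sq' ?_ (by positivity) |>.2
  rw [sinh_sq_upperRadius]
  have : 0 ≤ X * (X ^ 2 / 2) := by positivity
  nlinarith

/-- The constant in the decay estimate. -/
def decayConst (X₀ : ℝ) : ℝ :=
  2 * Real.pi * (2 / Real.sqrt X₀ + 74 + 48 / X₀ + 40 / X₀ ^ 2)

theorem norm_partsRemainder_sph_le {X X₀ t L : ℝ} (hX₀ : 0 < X₀) (hX : X₀ ≤ X) (ht1 : 1 ≤ |t|)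
    (ht2 : 2 / X₀ ≤ |t|) (ht3 : 4 / X₀ ^ 2 ≤ |t|) (hL : upperRadius X ≤ L) :
    ‖partsRemainder X (1 / 4 + |t| ^ 2) (sph (1 / 2 + Complex.I * t))
      (sphDeriv (1 / 2 + Complex.I * t)) L‖ ≤ decayConst X₀ * (X * Real.sqrt X) := by
  have hπ := Real.pi_pos
  have hX0 : 0 < X := hX₀.trans_le hX
  set x := Real.sqrt X with hx
  have hx0 : 0 < x := Real.sqrt_pos.2 hX0
  have hx2 : x ^ 2 = X := Real.sq_sqrt hX0.le
  have ht0 : 0 < |t| := by linarith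
  set r := Real.sqrt |t| with hr
  have hr0 : 0 < r := Real.sqrt_pos.2 ht0
  have hr2 : r ^ 2 = |t| := Real.sq_sqrt ht0.le
  have hr1 : 1 ≤ r := Real.one_le_sqrt.2 ht1
  have hφ := fun l => hasDerivAt_sph (1 / 2 + Complex.I * t) l
  have hv := fun l => hasDerivAt_sinh_mul_sphDeriv_half t l
  -- The condition `2 / X₀ ≤ |t|` puts the singular radius in the range of the energy bound:
  -- `sinh(1/|t|) ≤ 2/|t| ≤ X`.
  have hlow : ∀ l, lowerRadius X ≤ l → 1 / |t| ≤ l := by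
    intro l hl
    refine le_trans ?_ hl
    rw [← Real.sinh_le_sinh, sinh_lowerRadius]
    refine (sinh_le_two_mul (by positivity) (by rw [div_le_one ht0]; exact ht1)).trans ?_
    refine le_trans ?_ hX
    rw [div_le_iff₀ hX₀] at ht2
    rw [mul_one_div, div_le_iff₀ ht0]
    linarith
  have hbd := fun l (hl : lowerRadius X ≤ l) => sph_half_bounds ht1 (hlow l hl) hx0 hr0 hr2
    (by rw [hx2]; exact lowerRadius_le_iff.1 hl)
  set K := 8 * Real.pi / (r * x) with hK
  set K' := 18 * Real.pi * r / x with hK'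
  -- The cut with `R(m) = X/r`. The near piece costs `K' X R(m) ≪ X x` and the singular part of the
  -- next piece costs `K X² / R(m) ≪ x`, both free of `t`.
  set m := Real.arsinh (X * Real.sqrt (1 + 1 / |t|)) with hm
  have hSm2 : Real.sinh m ^ 2 = X ^ 2 * (1 + 1 / |t|) := by
    rw [hm, Real.sinh_arsinh, mul_pow, Real.sq_sqrt (by positivity)]
  have hSm0 : 0 < Real.sinh m := by
    rw [hm, Real.sinh_arsinh]
    positivity
  have hit : 1 / |t| ≤ 1 := by rw [div_le_one ht0]; exact ht1
  have hSm : Real.sinh m ≤ 2 * X := by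
    refine abs_le_of_sq_le_sq' ?_ (by positivity) |>.2
    rw [hSm2]
    have := mul_le_mul_of_nonneg_left hit (sq_nonneg X)
    nlinarith
  have hRm : rootR X m = X / r := by
    rw [rootR, hSm2]
    have : X ^ 2 * (1 + 1 / |t|) - X ^ 2 = (X / r) ^ 2 := by
      rw [div_pow, hr2]
      ring
    rw [this, Real.sqrt_sq (by positivity)]
  have hml : lowerRadius X < m := by
    rw [← Real.sinh_lt_sinh, sinh_lowerRadius]
    refine lt_of_pow_lt_pow_left₀ 2 hSm0.le ?_
    rw [hSm2]
    have : 0 < X ^ 2 * (1 / |t|) := by positivity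
    linarith
  -- This is where `4 / X₀² ≤ |t|` enters: it amounts to `X² / |t| ≤ X⁴ / 4`.
  have hmu : m ≤ upperRadius X := by
    rw [← Real.sinh_le_sinh]
    have h0 := Real.sinh_pos_iff.2 (upperRadius_pos hX0)
    refine abs_le_of_sq_le_sq' ?_ h0.le |>.2
    rw [hSm2, sinh_sq_upperRadius]
    have h1 : 4 ≤ |t| * X ^ 2 := by
      rw [div_le_iff₀ (by positivity)] at ht3
      exact ht3.trans (by gcongr)
    have h2 : 1 / |t| ≤ X ^ 2 / 4 := by
      rw [div_le_iff₀ ht0]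
      linarith
    have := mul_le_mul_of_nonneg_left h2 (sq_nonneg X)
    nlinarith
  have s0 := norm_partsRemainder_lowerRadius_le hX0 hφ hv (norm_sph_half_le t)
  have s1 := norm_partsRemainder_near_le hX0 hφ hv hml.le hmu fun l hl => (hbd l hl).2
  have s2 := norm_partsRemainder_upperRadius_le hX0 hφ hv hml hmu fun l hl => (hbd l hl).1
  have s3 := norm_partsRemainder_far_le hX0 hφ hv hL fun l hl => (hbd l hl).1
  have e1 : 3 * K' * Real.sinh m * rootR X m ≤ 108 * Real.pi * (X * x) := by
    rw [hRm, hK']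
    calc 3 * (18 * Real.pi * r / x) * Real.sinh m * (X / r)
        ≤ 3 * (18 * Real.pi * r / x) * (2 * X) * (X / r) := by gcongr
      _ = 108 * Real.pi * (X * X / x) := by
          field_simp
          norm_num
      _ = _ := by
          congr 1
          rw [← hx2]
          field_simp
  have hKX : K * (X * r) = 8 * Real.pi * x := by
    rw [hK, ← hx2]
    field_simp
  have hK0 : 0 < K := by positivity
  have hK1 : K ≤ 8 * Real.pi / x := by
    rw [hK]
    gcongr
    exact le_mul_of_one_le_left hx0.le hr1
  have hKX1 : K * X ≤ 8 * Real.pi * x := by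
    rw [← hKX]
    gcongr
    exact le_mul_of_one_le_right hX0.le hr1
  have hKX2 : K * X ^ 2 ≤ 8 * Real.pi * (X * x) := by
    have := mul_le_mul_of_nonneg_right hKX1 hX0.le
    linarith
  have e2 : Real.sinh m ^ 2 / rootR X m ≤ 2 * (X * r) := by
    rw [hRm, hSm2, div_le_iff₀ (by positivity)]
    have h1 : 2 * (X * r) * (X / r) = X ^ 2 * 2 := by
      field_simp
    rw [h1]
    gcongr
    linarith
  have e3 : X ^ 2 / rootR X m = X * r := by
    rw [hRm]
    field_simp
  have hSu := sinh_upperRadius_le hX0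
  have s2' : K * (Real.sinh m + 2 * (Real.sinh m ^ 2 / rootR X m) + 2 * (X ^ 2 / rootR X m) +
      (2 * Real.sinh (upperRadius X) + 2 * X ^ 2 + 4)) ≤
      K * (4 * X + 3 * X ^ 2 + 6 * (X * r) + 4) := by
    rw [e3]
    exact mul_le_mul_of_nonneg_left (by linarith) hK0.le
  have s3' : K * (2 * Real.sinh (upperRadius X) + X ^ 2 + 6) ≤
      K * (2 * X + 2 * X ^ 2 + 6) :=
    mul_le_mul_of_nonneg_left (by linarith) hK0.le
  have tot : ‖partsRemainder X (1 / 4 + |t| ^ 2) (sph (1 / 2 + Complex.I * t))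
      (sphDeriv (1 / 2 + Complex.I * t)) L‖ ≤
      4 * Real.pi * X + 148 * Real.pi * (X * x) + 96 * Real.pi * x + 80 * (Real.pi / x) := by
    have hK1' : K ≤ 8 * (Real.pi / x) := by rw [← mul_div_assoc]; exact hK1
    linarith
  refine tot.trans ?_
  have hs0 : 0 < Real.sqrt X₀ := Real.sqrt_pos.2 hX₀
  have hsx : Real.sqrt X₀ ≤ x := Real.sqrt_le_sqrt hX
  have f1 : X ≤ 1 / Real.sqrt X₀ * (X * x) := by
    rw [div_mul_eq_mul_div, le_div_iff₀ hs0, one_mul]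
    gcongr
  have f2 : x ≤ 1 / X₀ * (X * x) := by
    rw [div_mul_eq_mul_div, le_div_iff₀ hX₀, one_mul, mul_comm]
    gcongr
  have f3 : 1 / x ≤ 1 / X₀ ^ 2 * (X * x) := by
    rw [div_mul_eq_mul_div, div_le_div_iff₀ hx0 (by positivity), one_mul, one_mul]
    have : X * x * x = X ^ 2 := by
      rw [mul_assoc, ← sq, hx2]
      ring
    rw [this]
    gcongr
  have f1' := mul_le_mul_of_nonneg_left f1 (by positivity : 0 ≤ 4 * Real.pi)
  have f2' := mul_le_mul_of_nonneg_left f2 (by positivity : 0 ≤ 96 * Real.pi)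
  have f3' := mul_le_mul_of_nonneg_left f3 (by positivity : 0 ≤ 80 * Real.pi)
  have hXx : 0 ≤ Real.pi * (X * x) := by positivity
  have e : decayConst X₀ * (X * x) = 4 * Real.pi * (1 / Real.sqrt X₀ * (X * x)) +
      148 * (Real.pi * (X * x)) + 96 * Real.pi * (1 / X₀ * (X * x)) +
      80 * Real.pi * (1 / X₀ ^ 2 * (X * x)) := by
    rw [decayConst]
    ring
  have e4 : 80 * Real.pi * (1 / x) = 80 * (Real.pi / x) := by ring
  linarith

theorem integrableOn_weight_mul_sph {X : ℝ} (hX : 0 < X) (t : ℝ) :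
    IntegrableOn (fun l => (weight X l : ℂ) * sph (1 / 2 + Complex.I * t) l) (Set.Ioi 0) := by
  refine Integrable.mono'
    (integrableOn_weight_mul_sphR (σ := 1 / 2) hX (by norm_num) (by norm_num))
    ((Complex.continuous_ofReal.comp (continuous_weight hX)).mul
      (continuous_sph _)).aestronglyMeasurable ?_
  filter_upwards [ae_restrict_mem measurableSet_Ioi] with l hl
  have h0 := weight_nonneg hX (Set.mem_Ioi.1 hl).le
  rw [norm_mul, Complex.norm_real, Real.norm_of_nonneg h0]
  refine mul_le_mul_of_nonneg_left ((norm_sph_le _ _).trans_eq ?_) h0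
  rw [half_add_I_mul_re, Complex.ofReal_im, sub_zero]

theorem norm_selbergTransform_le_of_large {X X₀ t : ℝ} (hX₀ : 0 < X₀) (hX : X₀ ≤ X)
    (ht1 : 1 ≤ |t|) (ht2 : 2 / X₀ ≤ |t|) (ht3 : 4 / X₀ ^ 2 ≤ |t|) :
    ‖selbergTransform (kernelK X) (t : ℂ)‖ * (1 + |t|) ^ 2 ≤
      4 * decayConst X₀ * (X * Real.sqrt X) := by
  have hX0 : 0 < X := hX₀.trans_le hX
  have htr := tendsto_partsRemainder hX0 (Λ := 1 / 4 + |t| ^ 2) (by positivity)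
    (fun l => hasDerivAt_sinh_mul_sphDeriv_half t l) (norm_sph_half_le t)
    (integrableOn_weight_mul_sph hX0 t)
  have hle := le_of_tendsto htr.norm (by
    filter_upwards [eventually_ge_atTop (upperRadius X)] with L hL
    exact norm_partsRemainder_sph_le hX₀ hX ht1 ht2 ht3 hL)
  have e : selbergTransform (kernelK X) (t : ℂ) =
      ∫ l in Set.Ioi 0, (weight X l : ℂ) * sph (1 / 2 + Complex.I * t) l :=
    selbergTransform_eq_radial hX0 (by simp; norm_num)
  rw [← e, norm_mul, Complex.norm_real, Real.norm_of_nonneg (by positivity)] at hle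
  have h1 : (1 + |t|) ^ 2 ≤ 4 * (1 / 4 + |t| ^ 2) := by nlinarith
  have h2 := mul_le_mul_of_nonneg_left h1 (norm_nonneg (selbergTransform (kernelK X) (t : ℂ)))
  linarith

theorem norm_selbergTransform_real_le {X : ℝ} (hX : 0 < X) (t : ℝ) :
    ‖selbergTransform (kernelK X) (t : ℂ)‖ ≤ 1000 * (X * Real.sqrt X) := by
  have h := norm_selbergTransform_le (t := (t : ℂ)) hX (by simp; norm_num)
  rw [Complex.ofReal_im, sub_zero] at h
  have h2 := realTransform_le (s := 1 / 2) hX (by norm_num) (by norm_num)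
  have e : X ^ max (2 - 1 / 2 : ℝ) (1 + 1 / 2) = X * Real.sqrt X := by
    rw [Real.sqrt_eq_rpow, ← Real.rpow_one_add' hX.le (by norm_num)]
    norm_num
  rw [e] at h2
  exact h.trans h2

theorem exists_norm_selbergTransform_le {X₀ : ℝ} (hX₀ : 0 < X₀) :
    ∃ C : ℝ, ∀ X : ℝ, X₀ ≤ X → ∀ t : ℝ,
      ‖selbergTransform (kernelK X) (t : ℂ)‖ ≤ C * X ^ (1 + 1 / 2 : ℝ) / (1 + |t|) ^ 2 := by
  -- Above `T` the integrations by parts apply; below it `(1 + |t|)²` is bounded and the `s = 1/2`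
  -- estimate suffices.
  set T := max 1 (max (2 / X₀) (4 / X₀ ^ 2)) with hT
  have hd : 0 ≤ decayConst X₀ := by
    have := Real.pi_pos
    unfold decayConst
    positivity
  refine ⟨4 * decayConst X₀ + 1000 * (1 + T) ^ 2, fun X hX t => ?_⟩
  have hX0 : 0 < X := hX₀.trans_le hX
  have hXx : 0 ≤ X * Real.sqrt X := by positivity
  have e : X ^ (1 + 1 / 2 : ℝ) = X * Real.sqrt X := by
    rw [Real.sqrt_eq_rpow, ← Real.rpow_one_add' hX0.le (by norm_num)]
  rw [e, le_div_iff₀ (by positivity)]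
  rcases le_total T |t| with h | h
  · refine (norm_selbergTransform_le_of_large hX₀ hX ((le_max_left _ _).trans h)
      (((le_max_left _ _).trans (le_max_right _ _)).trans h)
      (((le_max_right _ _).trans (le_max_right _ _)).trans h)).trans ?_
    gcongr
    exact le_add_of_nonneg_right (by positivity)
  · calc ‖selbergTransform (kernelK X) (t : ℂ)‖ * (1 + |t|) ^ 2
        ≤ 1000 * (X * Real.sqrt X) * (1 + T) ^ 2 := by
          gcongr
          exact norm_selbergTransform_real_le hX0 t
      _ = 1000 * (1 + T) ^ 2 * (X * Real.sqrt X) := by ring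
      _ ≤ _ := by
          gcongr
          exact le_add_of_nonneg_left (by positivity)

end

theorem lemma18 :
    -- (a)
    (∀ X : ℝ, 0 < X →
      selbergTransform (kernelK X) (Complex.I / 2) = ((Real.pi * X ^ 2 : ℝ) : ℂ)) ∧
    (∃ C : ℝ, ∀ X : ℝ, 0 < X → ∀ (s : ℝ) (t : ℂ), 0 < s → s < 1 →
      (s : ℂ) = 1 / 2 + Complex.I * t →
        ‖selbergTransform (kernelK X) t‖ ≤ C * X ^ max (2 - s) (1 + s)) ∧
    -- (b)
    (∃ ε : ℝ, 0 < ε ∧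
      (∀ X : ℝ, 0 < X →
        (∀ t : ℂ, |t.im| ≤ 1 / 2 + ε →
          MeasureTheory.Integrable (selbergIntegrand (kernelK X) t)) ∧
        AnalyticOnNhd ℂ (selbergTransform (kernelK X)) {t : ℂ | |t.im| ≤ 1 / 2 + ε}) ∧
      (∀ X₀ : ℝ, 0 < X₀ → ∃ C : ℝ, ∀ X : ℝ, X₀ ≤ X → ∀ t : ℝ,
        ‖selbergTransform (kernelK X) (t : ℂ)‖ ≤ C * X ^ (1 + ε) / (1 + |t|) ^ 2)) := by
  refine ⟨fun X hX => selbergTransform_I_div_two hX,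
    ⟨1000, fun X hX s t h0 h1 hs => norm_selbergTransform_le_rpow hX h0 h1 hs⟩,
    -- `ε = 1/2` makes the exponent `1 + ε` equal to the `3/2` of the decay estimate, and the strip
    -- `|Im t| ≤ 1`.
    1 / 2, by norm_num, fun X hX => ⟨fun t ht => ?_, ?_⟩,
    fun X₀ hX₀ => exists_norm_selbergTransform_le hX₀⟩
  · exact integrable_selbergIntegrand hX (ht.trans (by norm_num))
  · have e : (1 / 2 + 1 / 2 : ℝ) = 1 := by norm_num
    rw [e]
    exact analyticOnNhd_selbergTransform hX
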